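/- Let $n$ be a dimension and let $g:[0,\infty)\to\mathbb{R}$ be twice differentiable with $G(t):=1+\int_0^t g(\tau)\,d\tau$, such that (E1) $g(t)>0$, $0\le g'(t)\le 1$ and $g''(t)\le 0$ for all $t\ge 0$; (E2) $1/g\notin L^1(0,\infty)$; (E3) there is $C_1>0$ with $|g'(t)|\le C_1\, g(t)\,\dfrac{g(t)}{G(t)}$ for all $t\ge 0$, and there is $t_0\ge 0$ with $|g''(t)|\le \dfrac{g'(t)}{g(t)}$ for all $t\ge t_0$. A Sobolev solution of the Cauchy problem $$u_{tt}-\Delta u+g(t)(-\Delta)u_t=0 \ \text{ in } (0,\infty)\times\mathbb{R}^n,\qquad u(0,\cdot)=u_0,\quad u_t(0,\cdot)=u_1,$$ is a function $u\in C([0,\infty);H^1(\mathbb{R}^n))\cap C^1([0,\infty);L^2(\mathbb{R}^n))$ with these initial values that satisfies the equation in the sense of distributions. For $C>0$ and $r\ge 0$ put $$M_{C,r}(t):=\max\Big\{G(t)^{-r/2},\ \exp\Big(-C\int_0^t\frac{d\tau}{g(\tau)}\Big)\Big\}.$$ Then there is a constant $C>0$ such that the following holds. (i) For every real $b\ge 1$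 there is $K>0$ such that for all data $u_0\in H^{b}$, $u_1\in H^{b-1}$, every Sobolev solution $u$ and all $t\ge 0$, $$\big\||D|^{b}u(t,\cdot)\big\|_{L^2}\le K\,M_{C,b}(t)\,\|u_0\|_{H^{b}}+K\,M_{C,b-1}(t)\,\|u_1\|_{H^{b-1}}.$$ (ii) For every real $b\ge 0$ there is $K>0$ such that for all data $u_0\in H^{b+1}$, $u_1\in H^{b}$, every Sobolev solution $u$ and all $t\ge 0$, $$\big\||D|^{b}u_t(t,\cdot)\big\|_{L^2}\le K\,M_{C,b+1}(t)\,\|u_0\|_{H^{b+1}}+K\,M_{C,b}(t)\,\|u_1\|_{H^{b}}.$$ (iii) (Parabolic effect.) If $\exp\big(-C\int_0^t 1/g\big)=O\big(G(t)^{-b/2}\big)$ as $t\to\infty$, then (i) holds for this $b\ge1$ (with some $K>0$) with $M_{C,b}$, $M_{C,b-1}$ replaced by $G^{-b/2}$, $G^{-(b-1)/2}$. If $\exp\big(-C\int_0^t 1/g\big)=O\big(G(t)^{-(b+1)/2}\big)$ as $t\to\infty$, then (ii) holds for this $b\ge0$ (with some $K>0$) with $M_{C,b+1}$, $M_{C,b}$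 replaced by $G^{-(b+1)/2}$, $G^{-b/2}$. The constant $C$ does not depend on $b$, and neither $C$ nor $K$ depends on $t$, $u_0$, $u_1$ or $u$. -/

import Mathlib

open Real Set Filter Topology MeasureTheory Asymptotics FourierTransform
open scoped ENNReal SchwartzMap Laplacian

noncomputable section

/-- The space `ℝⁿ` with the Euclidean norm. -/
abbrev Rn (n : ℕ) : Type := EuclideanSpace ℝ (Fin n)

/-- The space `L²(ℝⁿ)` of complex-valued functions. -/
abbrev L2 (n : ℕ) : Type := Lp ℂ 2 (volume : Measure (Rn n))

/-- The norm `‖|D|^s f‖_{L²}` (the `Ḣ^s` norm) of `f ∈ L²(ℝⁿ)`, with value `∞` if `|D|^s f` is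
not in `L²`. The Fourier transform is the one with kernel `exp (-2π i x·ξ)`, so that `|D|`, the
square root of `-Δ`, is the Fourier multiplier with symbol `2π|ξ|`. -/
def homNorm {n : ℕ} (s : ℝ) (f : L2 n) : ℝ≥0∞ :=
  eLpNorm (fun ξ : Rn n => ((2 * π * ‖ξ‖) ^ s : ℝ) • (𝓕 f : L2 n) ξ) 2 volume

/-- The norm `‖⟨D⟩^s f‖_{L²}` (the `H^s` norm) of `f ∈ L²(ℝⁿ)`, with value `∞` if `f ∉ H^s`. -/
def sobNorm {n : ℕ} (s : ℝ) (f : L2 n) : ℝ≥0∞ :=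
  eLpNorm (fun ξ : Rn n => ((1 + (2 * π * ‖ξ‖) ^ 2) ^ (s / 2) : ℝ) • (𝓕 f : L2 n) ξ) 2 volume

/-- The time derivative on `[0, ∞)` (one-sided at `t = 0`). -/
def timeDeriv {X : Type*} [NormedAddCommGroup X] [NormedSpace ℝ X] (u : ℝ → X) (t : ℝ) : X :=
  derivWithin u (Ici 0) t

/-- `G(t) = 1 + ∫₀ᵗ g(τ) dτ`. -/
def bigG (g : ℝ → ℝ) (t : ℝ) : ℝ := 1 + ∫ τ in (0 : ℝ)..t, g τ

/-- `exp (-C ∫₀ᵗ 1/g(τ) dτ)`. -/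
def expDecay (g : ℝ → ℝ) (C t : ℝ) : ℝ := Real.exp (-C * ∫ τ in (0 : ℝ)..t, 1 / g τ)

/-- `max { (1 + ∫₀ᵗ g)^(-r/2), exp (-C ∫₀ᵗ 1/g) }`. -/
def decayRate (g : ℝ → ℝ) (C r t : ℝ) : ℝ := max (bigG g t ^ (-(r / 2))) (expDecay g C t)

/-- The conditions on the coefficient `g`, a twice differentiable function on `[0, ∞)`. -/
structure SlowlyIncreasing (g : ℝ → ℝ) : Prop where
  diff : DifferentiableOn ℝ g (Ici 0)
  diff_deriv : DifferentiableOn ℝ (timeDeriv g) (Ici 0)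
  pos : ∀ t, 0 ≤ t → 0 < g t
  deriv_nonneg : ∀ t, 0 ≤ t → 0 ≤ timeDeriv g t
  deriv_le_one : ∀ t, 0 ≤ t → timeDeriv g t ≤ 1
  deriv2_nonpos : ∀ t, 0 ≤ t → timeDeriv (timeDeriv g) t ≤ 0
  not_integrable : ¬ IntegrableOn (fun t => 1 / g t) (Ioi 0) volume
  deriv_bound : ∃ C₁ : ℝ, 0 < C₁ ∧ ∀ t, 0 ≤ t → |timeDeriv g t| ≤ C₁ * g t * (g t / bigG g t)
  deriv2_bound : ∃ t₀ : ℝ, 0 ≤ t₀ ∧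
    ∀ t, t₀ ≤ t → |timeDeriv (timeDeriv g) t| ≤ timeDeriv g t / g t

/-- `u` is a Sobolev solution of the Cauchy problem
`u_tt - Δu + g(t)(-Δ)u_t = 0` on `(0, ∞) × ℝⁿ`, `u(0) = u₀`, `u_t(0) = u₁`:
it lies in `C([0, ∞); H¹) ∩ C¹([0, ∞); L²)`, has these initial values, and
satisfies the equation in the sense of distributions: for every Schwartz function `φ` and
`t > 0`, the function `⟨u_t, φ⟩` is differentiable at `t` with derivative
`⟨Δu(t), φ⟩ + g(t) ⟨Δu_t(t), φ⟩`, where `Δ` is the distributional Laplacian. -/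
structure IsSobolevSolution {n : ℕ} (g : ℝ → ℝ) (u₀ u₁ : L2 n) (u : ℝ → L2 n) : Prop where
  contDiff : ContDiffOn ℝ 1 u (Ici 0)
  mem_H1 : ∀ t, 0 ≤ t → sobNorm 1 (u t) < ∞
  cont_H1 : ∀ t, 0 ≤ t → Tendsto (fun τ => sobNorm 1 (u τ - u t)) (𝓝[Ici 0] t) (𝓝 0)
  init : u 0 = u₀
  init_deriv : timeDeriv u 0 = u₁
  equation : ∀ φ : 𝓢(Rn n, ℂ), ∀ t, 0 < t →
    HasDerivAt (fun τ => (Lp.toTemperedDistribution (timeDeriv u τ)) φ)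
      ((Δ (Lp.toTemperedDistribution (u t))) φ +
        (g t : ℂ) * (Δ (Lp.toTemperedDistribution (timeDeriv u t))) φ) t

end

/-! On the Fourier side, with p = 2π|ξ|, the equation is the damped oscillator w'' + g p² w' + p² w
= 0. Add to its energy a cross term with coefficient r/2, where r = g p²/(1 + (g p)²). The resulting
functional decays at rate r/4 up to the error caused by r'. That error is at most p g'/(1 + (g p)²)
= (arctan (g p))' times the functional, so it costs only a bounded factor over all time. Thus one
estimate, `energy_decay`, covers oscillating and overdamped modes together.

The rate r is at least g p²/2 while g p ≤ 1 and at least 1/(2g) once g p ≥ 1. Since g is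
nondecreasing, a mode changes regime at most once, at some time s. The first regime turns p^b into a
multiple of G(s)^(-b/2), the second contributes exp (-C ∫ₛᵗ 1/g). Concavity of g and g' ≤ 1 make G
comparable to (g 0 + t) g, and with this replacement the product of the two factors is quasiconvex
in s. It is therefore largest, up to constants, at s = 0 or s = t, which gives the two terms of the
maximum (`exists_bigG_rpow_mul_exp_le`). A mode overdamped from the start pays for p^b with the
Sobolev weight of the data.

A solution satisfies the equation only in the sense of distributions. A Bessel potential turns it
into an equation in L² (`hasDerivAt_bessel`). Restricted to bounded frequency sets, the Laplacian is
a bounded operator and `energy_decay` applies in L²; varying the set gives the bound for almost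
every frequency (`ae_energy_le`). -/

/-! ### Primitives on the half-line. -/

theorem continuousOn_integral_Ici {f : ℝ → ℝ} (hf : ContinuousOn f (Ici 0)) :
    ContinuousOn (fun t => ∫ s in (0 : ℝ)..t, f s) (Ici 0) := by
  intro t ht
  have ht' : 0 ≤ t + 1 := by linarith [mem_Ici.1 ht]
  have h1 : ContinuousOn (fun t => ∫ s in (0 : ℝ)..t, f s) (uIcc 0 (t + 1)) :=
    intervalIntegral.continuousOn_primitive_interval
      ((hf.mono (by rw [uIcc_of_le ht']; exact Icc_subset_Ici_self)).integrableOn_compact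
        isCompact_uIcc)
  rw [uIcc_of_le ht'] at h1
  refine (h1 t ⟨ht, by linarith⟩).mono_of_mem_nhdsWithin ?_
  exact mem_nhdsWithin.2 ⟨Iio (t + 1), isOpen_Iio, by simp, fun s hs => ⟨hs.2, hs.1.le⟩⟩

theorem intervalIntegrable_of_continuousOn_Ici {f : ℝ → ℝ} (hf : ContinuousOn f (Ici 0)) {s t : ℝ}
    (hs : 0 ≤ s) (ht : 0 ≤ t) : IntervalIntegrable f volume s t :=
  (hf.mono fun _ hx => (le_min hs ht).trans hx.1).intervalIntegrable

theorem hasDerivAt_integral_Ici {f : ℝ → ℝ} (hf : ContinuousOn f (Ici 0)) {t : ℝ} (ht : 0 < t) :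
    HasDerivAt (fun t => ∫ s in (0 : ℝ)..t, f s) (f t) t :=
  intervalIntegral.integral_hasDerivAt_right
    (intervalIntegrable_of_continuousOn_Ici hf le_rfl ht.le)
    (hf.stronglyMeasurableAtFilter_nhdsWithin measurableSet_Ici t |>.filter_mono
      (by rw [nhdsWithin_eq_nhds.2 (Ici_mem_nhds ht)]))
    (hf.continuousAt (Ici_mem_nhds ht))

/-! ### Energy decay for an abstract strongly damped oscillator. -/

/-- The instantaneous decay rate of the Fourier modes of frequency `a`, where `x` is the value of
the damping coefficient. -/
noncomputable def modeRate (a x : ℝ) : ℝ := x * a ^ 2 / (1 + (x * a) ^ 2)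

section Energy

variable {H : Type*} [NormedAddCommGroup H] [InnerProductSpace ℝ H]

theorem modeRate_nonneg {a x : ℝ} (hx : 0 ≤ x) : 0 ≤ modeRate a x := by
  unfold modeRate; positivity

theorem continuous_modeRate (a : ℝ) : Continuous (modeRate a) := by
  unfold modeRate
  exact Continuous.div (by fun_prop) (by fun_prop) fun x => by positivity

theorem hasDerivAt_modeRate (a x : ℝ) :
    HasDerivAt (modeRate a) (a ^ 2 * (1 - (x * a) ^ 2) / (1 + (x * a) ^ 2) ^ 2) x := by
  unfold modeRate
  have h1 : HasDerivAt (fun x : ℝ => x * a ^ 2) (1 * a ^ 2) x := (hasDerivAt_id x).mul_const _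
  have h2 : HasDerivAt (fun x : ℝ => 1 + (x * a) ^ 2) (2 * (x * a) * (1 * a)) x := by
    simpa using (((hasDerivAt_id x).mul_const a).pow 2).const_add 1
  refine (h1.div h2 (by positivity)).congr_deriv ?_
  field_simp
  ring

/-- The energy with a cross term, used to obtain decay of the modes of frequency `a`. -/
noncomputable def modeEnergy (A : H →L[ℝ] H) (c : ℝ) (y x : H) : ℝ :=
  2⁻¹ * inner ℝ x x + 2⁻¹ * inner ℝ (A y) y + c * inner ℝ x y

variable {A : H →L[ℝ] H} {a x : ℝ} {v w : H}

theorem abs_inner_mul_le (ha : 0 ≤ a) (hw : a ^ 2 * ‖w‖ ^ 2 ≤ inner ℝ (A w) w) :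
    a * |inner ℝ v w| ≤ 2⁻¹ * (inner ℝ v v + inner ℝ (A w) w) := by
  have h1 : |inner ℝ v w| ≤ ‖v‖ * ‖w‖ := abs_real_inner_le_norm v w
  rw [real_inner_self_eq_norm_sq]
  nlinarith [sq_nonneg (‖v‖ - a * ‖w‖), mul_le_mul_of_nonneg_left h1 ha]

/-- With y = x a this is y/(1 + y²) ≤ 1/2 combined with Cauchy–Schwarz. It keeps the cross term
small enough for `modeEnergy` to be equivalent to the plain energy. -/
theorem modeRate_mul_abs_inner_le (ha : 0 ≤ a) (hx : 0 ≤ x)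
    (hw : a ^ 2 * ‖w‖ ^ 2 ≤ inner ℝ (A w) w) :
    modeRate a x * |inner ℝ v w| ≤ 4⁻¹ * (inner ℝ v v + inner ℝ (A w) w) := by
  have h := abs_inner_mul_le (v := v) ha hw
  have h2 : x * a / (1 + (x * a) ^ 2) ≤ 2⁻¹ := by
    rw [div_le_iff₀ (by positivity)]
    nlinarith [sq_nonneg (x * a - 1)]
  have h0 : 0 ≤ x * a / (1 + (x * a) ^ 2) := by positivity
  have : modeRate a x * |inner ℝ v w| = x * a / (1 + (x * a) ^ 2) * (a * |inner ℝ v w|) := by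
    unfold modeRate; ring
  rw [this]
  calc _ ≤ 2⁻¹ * (2⁻¹ * (inner ℝ v v + inner ℝ (A w) w)) :=
        mul_le_mul h2 h (by positivity) (by norm_num)
    _ = _ := by ring

theorem modeEnergy_ge (ha : 0 ≤ a) (hx : 0 ≤ x) (hw : a ^ 2 * ‖w‖ ^ 2 ≤ inner ℝ (A w) w) :
    4⁻¹ * (inner ℝ v v + inner ℝ (A w) w) ≤ modeEnergy A (2⁻¹ * modeRate a x) w v := by
  have h := modeRate_mul_abs_inner_le (v := v) ha hx hw
  have h1 := mul_le_mul_of_nonneg_left (neg_abs_le (inner ℝ v w)) (modeRate_nonneg (a := a) hx)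
  have h2 : 0 ≤ inner ℝ v v + inner ℝ (A w) w := by
    rw [real_inner_self_eq_norm_sq]; nlinarith [sq_nonneg ‖v‖, sq_nonneg (a * ‖w‖)]
  unfold modeEnergy
  linarith

theorem modeEnergy_le (ha : 0 ≤ a) (hx : 0 ≤ x) (hw : a ^ 2 * ‖w‖ ^ 2 ≤ inner ℝ (A w) w) :
    modeEnergy A (2⁻¹ * modeRate a x) w v ≤ inner ℝ v v + inner ℝ (A w) w := by
  have h := modeRate_mul_abs_inner_le (v := v) ha hx hw
  have h1 := mul_le_mul_of_nonneg_left (le_abs_self (inner ℝ v w)) (modeRate_nonneg (a := a) hx)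
  have h2 : 0 ≤ inner ℝ v v + inner ℝ (A w) w := by
    rw [real_inner_self_eq_norm_sq]; nlinarith [sq_nonneg ‖v‖, sq_nonneg (a * ‖w‖)]
  unfold modeEnergy
  linarith

/-- Expand ⟨A(x v + w), x v + w⟩ ≥ 0. -/
theorem abs_inner_map_le (hA : ∀ y z, inner ℝ (A y) z = inner ℝ y (A z))
    (hA0 : ∀ y, 0 ≤ inner ℝ (A y) y) (x : ℝ) :
    -(x * inner ℝ (A v) w) ≤ 2⁻¹ * inner ℝ (A w) w + 2⁻¹ * x ^ 2 * inner ℝ (A v) v := by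
  have h := hA0 (x • v + w)
  simp only [map_add, map_smul, inner_add_left, inner_add_right, inner_smul_left,
    inner_smul_right, RCLike.conj_to_real] at h
  have : inner ℝ (A w) v = inner ℝ (A v) w := by rw [hA w v, real_inner_comm]
  rw [this] at h
  nlinarith

/-- The time derivative of `modeEnergy` along a solution is controlled by `modeEnergy`. -/
theorem deriv_modeEnergy_le (hA : ∀ y z, inner ℝ (A y) z = inner ℝ y (A z))
    (hA0 : ∀ y, 0 ≤ inner ℝ (A y) y) (ha : 0 ≤ a) (hx : 0 ≤ x)
    (hw : a ^ 2 * ‖w‖ ^ 2 ≤ inner ℝ (A w) w) (hv : a ^ 2 * ‖v‖ ^ 2 ≤ inner ℝ (A v) v)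
    {x' : ℝ} (hx' : 0 ≤ x') :
    inner ℝ (-(x • A v) - A w) v + inner ℝ (A w) v +
      (2⁻¹ * (a ^ 2 * (1 - (x * a) ^ 2) / (1 + (x * a) ^ 2) ^ 2 * x') * inner ℝ v w +
        2⁻¹ * modeRate a x * (inner ℝ (-(x • A v) - A w) w + inner ℝ v v)) ≤
      (a * x' / (1 + (x * a) ^ 2) - 4⁻¹ * modeRate a x) * modeEnergy A (2⁻¹ * modeRate a x) w v := by
  set r := modeRate a x with hr
  have hr0 : 0 ≤ r := modeRate_nonneg hx
  have hE : 0 ≤ inner ℝ v v + inner ℝ (A w) w := by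
    rw [real_inner_self_eq_norm_sq]; nlinarith [sq_nonneg ‖v‖, sq_nonneg (a * ‖w‖)]
  have h1 := modeEnergy_ge (v := v) ha hx hw
  have h2 := modeEnergy_le (v := v) ha hx hw
  rw [← hr] at h1 h2
  have hθ : 0 ≤ a * x' / (1 + (x * a) ^ 2) := by positivity
  have h3 := mul_le_mul_of_nonneg_left h1 hθ
  have h4 := mul_le_mul_of_nonneg_left h2 hr0
  have h5 := mul_le_mul_of_nonneg_left (abs_inner_map_le (v := v) (w := w) hA hA0 x) hr0
  -- Two bounds on the rate share out the dissipation x⟨Av, v⟩: by r x² ≤ x a quarter of it absorbs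
  -- the mixed term ⟨Av, w⟩, and by r ≤ x a² the other three quarters dominate the terms in r⟨v, v⟩.
  have hrx : r * x ^ 2 ≤ x := by
    rw [hr]; unfold modeRate
    rw [div_mul_eq_mul_div, div_le_iff₀ (by positivity)]
    nlinarith
  have hra : r ≤ x * a ^ 2 := by
    rw [hr]; unfold modeRate
    rw [div_le_iff₀ (by positivity)]
    have : 0 ≤ x * a ^ 2 := by positivity
    nlinarith [sq_nonneg (x * a)]
  have h6 := mul_le_mul_of_nonneg_right hrx (hA0 v)
  have h7 : r * inner ℝ v v ≤ x * inner ℝ (A v) v := by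
    rw [real_inner_self_eq_norm_sq]
    nlinarith [mul_le_mul_of_nonneg_left hv hx, mul_le_mul_of_nonneg_right hra (sq_nonneg ‖v‖)]
  -- The derivative of the rate is a² q/(1 + (x a)²) with |q| ≤ 1; one factor a goes into a|⟨v, w⟩|,
  -- which the energy controls, and the other stays to form the derivative of arctan (x a).
  have h8 : a ^ 2 * (1 - (x * a) ^ 2) / (1 + (x * a) ^ 2) ^ 2 * x' * inner ℝ v w ≤
      a * x' / (1 + (x * a) ^ 2) * (2⁻¹ * (inner ℝ v v + inner ℝ (A w) w)) := by
    have e : a ^ 2 * (1 - (x * a) ^ 2) / (1 + (x * a) ^ 2) ^ 2 * x' * inner ℝ v w =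
        a * x' / (1 + (x * a) ^ 2) *
          (((1 - (x * a) ^ 2) / (1 + (x * a) ^ 2)) * (a * inner ℝ v w)) := by
      field_simp
    rw [e]
    refine mul_le_mul_of_nonneg_left ?_ hθ
    have hq : |(1 - (x * a) ^ 2) / (1 + (x * a) ^ 2)| ≤ 1 := by
      rw [abs_div, abs_of_pos (show 0 < 1 + (x * a) ^ 2 by positivity),
        div_le_one (by positivity), abs_le]
      constructor <;> nlinarith [sq_nonneg (x * a)]
    calc _ ≤ |((1 - (x * a) ^ 2) / (1 + (x * a) ^ 2)) * (a * inner ℝ v w)| := le_abs_self _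
      _ ≤ 1 * (a * |inner ℝ v w|) := by
        rw [abs_mul, abs_mul a, abs_of_nonneg ha]
        exact mul_le_mul_of_nonneg_right hq (by positivity)
      _ ≤ _ := by rw [one_mul]; exact abs_inner_mul_le ha hw
  have e1 : inner ℝ (-(x • A v) - A w) v = -(x * inner ℝ (A v) v) - inner ℝ (A w) v := by
    simp [inner_sub_left, inner_neg_left, inner_smul_left]
  have e2 : inner ℝ (-(x • A v) - A w) w = -(x * inner ℝ (A v) w) - inner ℝ (A w) w := by
    simp [inner_sub_left, inner_neg_left, inner_smul_left]
  rw [e1, e2]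
  have h9 : 0 ≤ x * inner ℝ (A v) v := mul_nonneg hx (hA0 v)
  nlinarith

/-- Decay of the energy of the modes of frequency at least `a` of a strongly damped wave
equation. -/
theorem energy_decay {g g' : ℝ → ℝ} (hgc : ContinuousOn g (Ici 0)) (hg0 : ∀ t, 0 ≤ t → 0 ≤ g t)
    (hg : ∀ t, 0 < t → HasDerivAt g (g' t) t) (hg' : ∀ t, 0 < t → 0 ≤ g' t)
    (hA : ∀ y z, inner ℝ (A y) z = inner ℝ y (A z)) (hA0 : ∀ y, 0 ≤ inner ℝ (A y) y) (ha : 0 ≤ a)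
    {w v : ℝ → H} (hwc : ContinuousOn w (Ici 0)) (hvc : ContinuousOn v (Ici 0))
    (hw : ∀ t, 0 < t → HasDerivAt w (v t) t)
    (hv : ∀ t, 0 < t → HasDerivAt v (-(g t • A (v t)) - A (w t)) t)
    (hwa : ∀ t, 0 ≤ t → a ^ 2 * ‖w t‖ ^ 2 ≤ inner ℝ (A (w t)) (w t))
    (hva : ∀ t, 0 ≤ t → a ^ 2 * ‖v t‖ ^ 2 ≤ inner ℝ (A (v t)) (v t)) {t : ℝ} (ht : 0 ≤ t) :
    inner ℝ (v t) (v t) + inner ℝ (A (w t)) (w t) ≤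
      4 * exp 2 * exp (-(4⁻¹ * ∫ s in (0 : ℝ)..t, modeRate a (g s))) *
        (inner ℝ (v 0) (v 0) + inner ℝ (A (w 0)) (w 0)) := by
  set L : ℝ → ℝ := fun t => modeEnergy A (2⁻¹ * modeRate a (g t)) (w t) (v t) with hL
  set I : ℝ → ℝ := fun t => ∫ s in (0 : ℝ)..t, modeRate a (g s) with hI
  have hrc : ContinuousOn (fun s => modeRate a (g s)) (Ici 0) :=
    (continuous_modeRate a).comp_continuousOn hgc
  have hIc : ContinuousOn I (Ici 0) := continuousOn_integral_Ici hrc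
  have hId : ∀ t, 0 < t → HasDerivAt I (modeRate a (g t)) t := fun t ht =>
    hasDerivAt_integral_Ici hrc ht
  -- The arctangent is the primitive of the error a g'/(1 + (g a)²) in `deriv_modeEnergy_le`, so
  -- this weight makes the functional nonincreasing. As 0 ≤ arctan < π/2 < 2 here, removing it costs
  -- the factor exp 2.
  set Y : ℝ → ℝ := fun t => L t * exp (4⁻¹ * I t - arctan (g t * a)) with hY
  have hYd : ∀ t, 0 < t → HasDerivAt Y
      ((2⁻¹ * (inner ℝ (v t) (-(g t • A (v t)) - A (w t)) +
          inner ℝ (-(g t • A (v t)) - A (w t)) (v t)) +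
        2⁻¹ * (inner ℝ (A (w t)) (v t) + inner ℝ (A (v t)) (w t)) +
        ((2⁻¹ * (a ^ 2 * (1 - (g t * a) ^ 2) / (1 + (g t * a) ^ 2) ^ 2 * g' t)) *
            inner ℝ (v t) (w t) +
          2⁻¹ * modeRate a (g t) * (inner ℝ (v t) (v t) +
            inner ℝ (-(g t • A (v t)) - A (w t)) (w t)))) *
          exp (4⁻¹ * I t - arctan (g t * a)) +
        L t * (exp (4⁻¹ * I t - arctan (g t * a)) *
          (4⁻¹ * modeRate a (g t) - 1 / (1 + (g t * a) ^ 2) * (g' t * a)))) t := by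
    intro t ht
    have h1 := ((hasDerivAt_modeRate a (g t)).comp t (hg t ht)).const_mul 2⁻¹
    have h2 := (((hId t ht).const_mul 4⁻¹).sub ((hg t ht).mul_const a).arctan).exp
    have h3 := (((hv t ht).inner ℝ (hv t ht)).const_mul 2⁻¹).add
      ((((A.hasFDerivAt.comp_hasDerivAt t (hw t ht)).inner ℝ (hw t ht))).const_mul 2⁻¹)
    exact (h3.add (h1.mul ((hv t ht).inner ℝ (hw t ht)))).mul h2
  have hYanti : AntitoneOn Y (Ici 0) := by
    refine antitoneOn_of_deriv_nonpos (convex_Ici 0) ?_ ?_ ?_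
    · refine ContinuousOn.mul ?_ (Real.continuous_exp.comp_continuousOn ?_)
      · simp only [hL, modeEnergy]
        have := A.continuous.comp_continuousOn hwc
        exact ((continuousOn_const.mul (hvc.inner hvc)).add
          (continuousOn_const.mul (this.inner hwc))).add
          ((continuousOn_const.mul hrc).mul (hvc.inner hwc))
      · exact (continuousOn_const.mul hIc).sub
          (continuous_arctan.comp_continuousOn (hgc.mul continuousOn_const))
    · rw [interior_Ici]
      exact fun t ht => (hYd t ht).differentiableAt.differentiableWithinAt
    · rw [interior_Ici]
      intro t ht
      have ht0 : 0 ≤ t := le_of_lt ht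
      rw [(hYd t ht).deriv]
      have h := deriv_modeEnergy_le hA hA0 ha (hg0 t ht0) (hwa t ht0) (hva t ht0) (hg' t ht)
      have e : inner ℝ (A (v t)) (w t) = inner ℝ (A (w t)) (v t) := by
        rw [hA, real_inner_comm]
      have he := exp_pos (4⁻¹ * I t - arctan (g t * a))
      refine le_of_eq_of_le ?_ (mul_nonpos_of_nonpos_of_nonneg (sub_nonpos.2 h) he.le)
      rw [e, real_inner_comm (-(g t • A (v t)) - A (w t)) (v t)]
      simp only [hL]
      ring
  have h0 := hYanti self_mem_Ici ht ht
  have hI0 : I 0 = 0 := by simp [hI]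
  simp only [hY, hI0, mul_zero, zero_sub] at h0
  have hE : 0 ≤ inner ℝ (v 0) (v 0) + inner ℝ (A (w 0)) (w 0) :=
    add_nonneg real_inner_self_nonneg (hA0 _)
  have h1 := modeEnergy_ge (v := v t) ha (hg0 t ht) (hwa t ht)
  have h2 := modeEnergy_le (v := v 0) ha (hg0 0 le_rfl) (hwa 0 le_rfl)
  have h3 : exp (-arctan (g 0 * a)) ≤ 1 :=
    exp_le_one_iff.2 (neg_nonpos.2 (arctan_nonneg.2 (mul_nonneg (hg0 0 le_rfl) ha)))
  have h4 : exp (4⁻¹ * I t - 2) ≤ exp (4⁻¹ * I t - arctan (g t * a)) := by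
    refine exp_le_exp.2 ?_
    linarith [arctan_lt_pi_div_two (g t * a), pi_lt_four]
  have h5 : 4⁻¹ * (inner ℝ (v t) (v t) + inner ℝ (A (w t)) (w t)) * exp (4⁻¹ * I t - 2) ≤
      inner ℝ (v 0) (v 0) + inner ℝ (A (w 0)) (w 0) := by
    have hEt : 0 ≤ inner ℝ (v t) (v t) + inner ℝ (A (w t)) (w t) :=
      add_nonneg real_inner_self_nonneg (hA0 _)
    calc _ ≤ L t * exp (4⁻¹ * I t - arctan (g t * a)) :=
          mul_le_mul h1 h4 (exp_pos _).le (le_trans (by positivity) h1)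
      _ ≤ L 0 * exp (-arctan (g 0 * a)) := h0
      _ ≤ (inner ℝ (v 0) (v 0) + inner ℝ (A (w 0)) (w 0)) * 1 :=
          mul_le_mul h2 h3 (exp_pos _).le hE
      _ = _ := mul_one _
  have h6 : exp (4⁻¹ * I t - 2) * (exp 2 * exp (-(4⁻¹ * I t))) = 1 := by
    rw [← exp_add, ← exp_add, ← exp_zero]
    congr 1
    ring
  have h7 := mul_le_mul_of_nonneg_right h5
    (show 0 ≤ 4 * (exp 2 * exp (-(4⁻¹ * I t))) by positivity)
  calc _ = 4⁻¹ * (inner ℝ (v t) (v t) + inner ℝ (A (w t)) (w t)) * exp (4⁻¹ * I t - 2) *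
        (4 * (exp 2 * exp (-(4⁻¹ * I t)))) := by
          linear_combination (-(inner ℝ (v t) (v t) + inner ℝ (A (w t)) (w t))) * h6
    _ ≤ _ := h7
    _ = _ := by ring

end Energy

/-! ### Growth of g and G, and the resulting decay of single modes. -/

theorem exists_rpow_mul_exp_neg_le (β : ℝ) {c : ℝ} (hc : 0 < c) :
    ∃ K : ℝ, 1 ≤ K ∧ ∀ x : ℝ, 0 ≤ x → 0 ≤ β → x ^ β * exp (-(c * x)) ≤ K := by
  obtain ⟨n, hn⟩ := exists_nat_ge β
  refine ⟨1 + n.factorial / c ^ n, by simp; positivity, fun x hx hβ => ?_⟩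
  have h1 : x ^ β ≤ 1 + x ^ n := by
    rcases le_total x 1 with h | h
    · exact (rpow_le_one hx h hβ).trans (by simp; positivity)
    · calc x ^ β ≤ x ^ (n : ℝ) := rpow_le_rpow_of_exponent_le h hn
        _ = x ^ n := rpow_natCast x n
        _ ≤ _ := by simp
  have h2 : (c * x) ^ n / n.factorial ≤ exp (c * x) := pow_div_factorial_le_exp _ (by positivity) n
  have h3 : x ^ n ≤ n.factorial / c ^ n * exp (c * x) := by
    rw [div_le_iff₀ (by positivity), mul_pow] at h2
    rw [div_mul_eq_mul_div, le_div_iff₀ (by positivity)]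
    linarith
  have h4 : 1 ≤ exp (c * x) := one_le_exp (by positivity)
  rw [exp_neg, ← div_eq_mul_inv, div_le_iff₀ (exp_pos _)]
  linarith

namespace SlowlyIncreasing

variable {g : ℝ → ℝ} (hg : SlowlyIncreasing g)
include hg

theorem continuousOn : ContinuousOn g (Ici 0) := hg.diff.continuousOn

theorem hasDerivAt {t : ℝ} (ht : 0 < t) : HasDerivAt g (timeDeriv g t) t :=
  (hg.diff t ht.le).hasDerivWithinAt.hasDerivAt (Ici_mem_nhds ht)

theorem monotoneOn : MonotoneOn g (Ici 0) := by
  refine monotoneOn_of_deriv_nonneg (convex_Ici 0) hg.continuousOn ?_ ?_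
  all_goals rw [interior_Ici]; intro t ht
  · exact (hg.hasDerivAt ht).differentiableAt.differentiableWithinAt
  · rw [(hg.hasDerivAt ht).deriv]; exact hg.deriv_nonneg t (le_of_lt ht)

theorem antitoneOn_timeDeriv : AntitoneOn (timeDeriv g) (Ici 0) := by
  have h : ∀ t, 0 < t → HasDerivAt (timeDeriv g) (timeDeriv (timeDeriv g) t) t := fun t ht =>
    (hg.diff_deriv t ht.le).hasDerivWithinAt.hasDerivAt (Ici_mem_nhds ht)
  refine antitoneOn_of_deriv_nonpos (convex_Ici 0) hg.diff_deriv.continuousOn ?_ ?_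
  all_goals rw [interior_Ici]; intro t ht
  · exact (h t ht).differentiableAt.differentiableWithinAt
  · rw [(h t ht).deriv]; exact hg.deriv2_nonpos t (le_of_lt ht)

/-- Concavity: on [0, t] the slope of g is at least its slope at t. -/
theorem timeDeriv_mul_le {t : ℝ} (ht : 0 ≤ t) : timeDeriv g t * t ≤ g t - g 0 := by
  have h := (convex_Icc 0 t).mul_sub_le_image_sub_of_le_deriv (f := g) (C := timeDeriv g t)
    (hg.continuousOn.mono Icc_subset_Ici_self)
    (fun x hx => (hg.hasDerivAt
      (by rw [interior_Icc] at hx; exact hx.1)).differentiableAt.differentiableWithinAt)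
    (fun x hx => by
      rw [interior_Icc] at hx
      rw [(hg.hasDerivAt hx.1).deriv]
      exact hg.antitoneOn_timeDeriv hx.1.le ht hx.2.le)
    0 (left_mem_Icc.2 ht) t (right_mem_Icc.2 ht) ht
  simpa using h

theorem le_add {t : ℝ} (ht : 0 ≤ t) : g t ≤ g 0 + t := by
  have h := (convex_Icc 0 t).image_sub_le_mul_sub_of_deriv_le (f := g) (C := 1)
    (hg.continuousOn.mono Icc_subset_Ici_self)
    (fun x hx => (hg.hasDerivAt
      (by rw [interior_Icc] at hx; exact hx.1)).differentiableAt.differentiableWithinAt)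
    (fun x hx => by
      rw [interior_Icc] at hx
      rw [(hg.hasDerivAt hx.1).deriv]
      exact hg.deriv_le_one x hx.1.le)
    0 (left_mem_Icc.2 ht) t (right_mem_Icc.2 ht) ht
  linarith

theorem one_le_bigG {t : ℝ} (ht : 0 ≤ t) : 1 ≤ bigG g t := by
  unfold bigG
  have := intervalIntegral.integral_nonneg (μ := volume) ht fun s hs => (hg.pos s hs.1).le
  linarith

theorem continuousOn_bigG : ContinuousOn (bigG g) (Ici 0) :=
  continuousOn_const.add (continuousOn_integral_Ici hg.continuousOn)

theorem hasDerivAt_bigG {t : ℝ} (ht : 0 < t) : HasDerivAt (bigG g) (g t) t :=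
  (hasDerivAt_integral_Ici hg.continuousOn ht).const_add 1

theorem bigG_le {t : ℝ} (ht : 0 ≤ t) : bigG g t ≤ 1 + t * g t := by
  unfold bigG
  have := intervalIntegral.integral_mono_on ht
    (intervalIntegrable_of_continuousOn_Ici hg.continuousOn le_rfl ht)
    (intervalIntegrable_const (c := g t)) fun s hs => hg.monotoneOn hs.1 ht hs.2
  simp at this
  linarith

/-- The difference of the two sides has derivative g - t g' ≥ g 0 > 0 by concavity. -/
theorem mul_le_bigG {t : ℝ} (ht : 0 ≤ t) : t * g t ≤ 2 * (bigG g t - 1) := by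
  have h : MonotoneOn (fun t => 2 * (bigG g t - 1) - t * g t) (Ici 0) := by
    have hd : ∀ t, 0 < t → HasDerivAt (fun t => 2 * (bigG g t - 1) - t * g t)
        (2 * g t - (1 * g t + t * timeDeriv g t)) t := fun t ht =>
      (((hg.hasDerivAt_bigG ht).sub_const 1).const_mul 2).sub
        ((hasDerivAt_id t).mul (hg.hasDerivAt ht))
    refine monotoneOn_of_deriv_nonneg (convex_Ici 0) ?_ ?_ ?_
    · exact (continuousOn_const.mul (hg.continuousOn_bigG.sub continuousOn_const)).sub
        (continuousOn_id.mul hg.continuousOn)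
    all_goals rw [interior_Ici]; intro t ht
    · exact (hd t ht).differentiableAt.differentiableWithinAt
    · rw [(hd t ht).deriv]
      linarith [hg.timeDeriv_mul_le (le_of_lt ht), hg.pos 0 le_rfl]
  have := h self_mem_Ici ht ht
  simp [bigG] at this ⊢
  linarith

/-- The numerator of the derivative is (t g' - g) + g 0 · g', where t g' ≤ g - g 0 and g' ≤ 1. -/
theorem div_antitoneOn : AntitoneOn (fun t => g t / (g 0 + t)) (Ici 0) := by
  have h0 := hg.pos 0 le_rfl
  have hd : ∀ t, 0 < t → HasDerivAt (fun t => g t / (g 0 + t))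
      ((timeDeriv g t * (g 0 + t) - g t * 1) / (g 0 + t) ^ 2) t := fun t ht =>
    (hg.hasDerivAt ht).div ((hasDerivAt_id t).const_add (g 0)) (by simp; positivity)
  refine antitoneOn_of_deriv_nonpos (convex_Ici 0) ?_ ?_ ?_
  · exact hg.continuousOn.div (by fun_prop) fun t ht => by
      have : (0 : ℝ) ≤ t := ht
      positivity
  all_goals rw [interior_Ici]; intro t ht
  · exact (hd t ht).differentiableAt.differentiableWithinAt
  · rw [(hd t ht).deriv]
    have ht0 : 0 ≤ t := le_of_lt ht
    refine div_nonpos_of_nonpos_of_nonneg ?_ (by positivity)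
    nlinarith [hg.timeDeriv_mul_le ht0, hg.deriv_le_one t ht0]

theorem continuousOn_one_div : ContinuousOn (fun t => 1 / g t) (Ici 0) :=
  continuousOn_const.div hg.continuousOn fun t ht => (hg.pos t ht).ne'

/-- The function `(g 0 + t) * g t` is comparable to `bigG g`, and its logarithmic derivative times
`g` is antitone; hence `β * log ((g 0 + t) * g t) - C * ∫₀ᵗ 1/g` is quasiconcave. -/
theorem min_le_log_sub {β C s t : ℝ} (hβ : 0 ≤ β) (hs : 0 ≤ s) (hst : s ≤ t) :
    min (β * log ((g 0 + 0) * g 0) - C * ∫ τ in (0 : ℝ)..0, 1 / g τ)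
        (β * log ((g 0 + t) * g t) - C * ∫ τ in (0 : ℝ)..t, 1 / g τ) ≤
      β * log ((g 0 + s) * g s) - C * ∫ τ in (0 : ℝ)..s, 1 / g τ := by
  set h : ℝ → ℝ := fun t => β * log ((g 0 + t) * g t) - C * ∫ τ in (0 : ℝ)..t, 1 / g τ with hh
  set ρ : ℝ → ℝ := fun t => β * (g t / (g 0 + t) + timeDeriv g t) - C with hρ
  have h0 := hg.pos 0 le_rfl
  have hρa : AntitoneOn ρ (Ici 0) := fun x hx y hy hxy => by
    have h1 := hg.div_antitoneOn hx hy hxy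
    have h2 := hg.antitoneOn_timeDeriv hx hy hxy
    have := mul_le_mul_of_nonneg_left (add_le_add h1 h2) hβ
    simp only [hρ]
    linarith
  have hd : ∀ t, 0 < t → HasDerivAt h (1 / g t * ρ t) t := fun t ht => by
    have hgt := hg.pos t ht.le
    have h1 : HasDerivAt (fun t => (g 0 + t) * g t) (1 * g t + (g 0 + t) * timeDeriv g t) t :=
      ((hasDerivAt_id t).const_add (g 0)).mul (hg.hasDerivAt ht)
    refine (((h1.log (by positivity)).const_mul β).sub
      ((hasDerivAt_integral_Ici hg.continuousOn_one_div ht).const_mul C)).congr_deriv ?_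
    simp only [hρ]
    field_simp
  have hc : ContinuousOn h (Ici 0) := by
    refine (continuousOn_const.mul (ContinuousOn.log ?_ ?_)).sub
      (continuousOn_const.mul (continuousOn_integral_Ici hg.continuousOn_one_div))
    · exact ContinuousOn.mul (by fun_prop) hg.continuousOn
    · intro x hx
      have : (0 : ℝ) ≤ x := hx
      have := hg.pos x hx
      positivity
  change min (h 0) (h t) ≤ h s
  -- `h` has derivative ρ/g with ρ antitone, so it increases up to s if ρ(s) ≥ 0 and decreases from
  -- s on otherwise.
  rcases le_total 0 (ρ s) with hρs | hρs
  · refine (min_le_left _ _).trans ?_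
    refine monotoneOn_of_deriv_nonneg (convex_Icc 0 s) (hc.mono Icc_subset_Ici_self) ?_ ?_
      (left_mem_Icc.2 hs) (right_mem_Icc.2 hs) hs
    all_goals rw [interior_Icc]; intro x hx
    · exact (hd x hx.1).differentiableAt.differentiableWithinAt
    · rw [(hd x hx.1).deriv]
      exact mul_nonneg (one_div_nonneg.2 (hg.pos x hx.1.le).le)
        (hρs.trans (hρa hx.1.le hs hx.2.le))
  · refine (min_le_right _ _).trans ?_
    refine antitoneOn_of_deriv_nonpos (convex_Icc s t)
      (hc.mono fun x hx => hs.trans hx.1) ?_ ?_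
      (left_mem_Icc.2 hst) (right_mem_Icc.2 hst) hst
    all_goals rw [interior_Icc]; intro x hx
    · exact (hd x (hs.trans_lt hx.1)).differentiableAt.differentiableWithinAt
    · rw [(hd x (hs.trans_lt hx.1)).deriv]
      exact mul_nonpos_of_nonneg_of_nonpos (one_div_nonneg.2 (hg.pos x (hs.trans hx.1.le)).le)
        ((hρa hs (hs.trans hx.1.le) hx.1.le).trans hρs)

theorem exists_bigG_le : ∃ c : ℝ, 0 < c ∧ ∀ t, 0 ≤ t → bigG g t ≤ c * ((g 0 + t) * g t) := by
  have h0 := hg.pos 0 le_rfl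
  refine ⟨1 / g 0 ^ 2 + 1, by positivity, fun t ht => ?_⟩
  have h1 := hg.bigG_le ht
  have h2 := hg.monotoneOn self_mem_Ici ht ht
  have h3 : g 0 ^ 2 ≤ (g 0 + t) * g t := by nlinarith
  have h4 : 1 ≤ 1 / g 0 ^ 2 * ((g 0 + t) * g t) := by
    rw [one_div_mul_eq_div, le_div_iff₀ (by positivity)]; linarith
  nlinarith [mul_pos h0 (hg.pos t ht)]

/-- Here g 0 · g ≤ g 0 (g 0 + t) ≤ (g 0)² + t g and t g ≤ 2(G - 1), which explains the constant (g
0)² + 4. -/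
theorem exists_le_bigG : ∃ c : ℝ, 0 < c ∧ ∀ t, 0 ≤ t → (g 0 + t) * g t ≤ c * bigG g t := by
  have h0 := hg.pos 0 le_rfl
  refine ⟨g 0 ^ 2 + 4, by positivity, fun t ht => ?_⟩
  have h1 := hg.mul_le_bigG ht
  have h2 := hg.le_add ht
  have h3 := hg.monotoneOn self_mem_Ici ht ht
  have h4 := hg.one_le_bigG ht
  nlinarith [mul_nonneg ht (sub_nonneg.2 h3), mul_nonneg (sq_nonneg (g 0)) (sub_nonneg.2 h4)]

/-- The decay before and after a time `s` combined is at least the decay described by one of the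
two terms of `decayRate`. -/
theorem exists_bigG_rpow_mul_exp_le {β : ℝ} (hβ : 0 ≤ β) (C : ℝ) :
    ∃ K : ℝ, 1 ≤ K ∧ ∀ s t, 0 ≤ s → s ≤ t →
      bigG g s ^ (-β) * exp (-C * ∫ τ in s..t, 1 / g τ) ≤
        K * max (bigG g t ^ (-β)) (expDecay g C t) := by
  obtain ⟨c, hc, hcG⟩ := hg.exists_bigG_le
  obtain ⟨d, hd, hdG⟩ := hg.exists_le_bigG
  have h0 := hg.pos 0 le_rfl
  have hpos : ∀ t, 0 ≤ t → 0 < (g 0 + t) * g t := fun t ht => by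
    have := hg.pos t ht
    positivity
  have hG : ∀ t, 0 ≤ t → 0 < bigG g t := fun t ht => one_pos.trans_le (hg.one_le_bigG ht)
  set K₀ := max 1 (((g 0 + 0) * g 0) ^ (-β))
  set K₁ := max 1 (d ^ β * (max (c ^ β) 1 * K₀)) with hK₁
  refine ⟨K₁, le_max_left _ _, fun s t hs hst => ?_⟩
  have ht := hs.trans hst
  have e1 : ∀ t, 0 ≤ t → exp (-(β * log ((g 0 + t) * g t) - C * ∫ τ in (0 : ℝ)..t, 1 / g τ)) =
      ((g 0 + t) * g t) ^ (-β) * exp (C * ∫ τ in (0 : ℝ)..t, 1 / g τ) := fun t ht => by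
    rw [rpow_def_of_pos (hpos t ht), ← exp_add]; congr 1; ring
  -- Exponentiating the negated inequality turns the minimum over the endpoints into a maximum.
  -- Multiplication by exp (-C ∫₀ᵗ 1/g) then leaves the exponential term at s = 0 and the power term
  -- at s = t.
  have hmin := exp_le_exp.2 (neg_le_neg (hg.min_le_log_sub (C := C) hβ hs hst))
  rw [← max_neg_neg, Real.exp_monotone.map_max, e1 s hs, e1 t ht, e1 0 le_rfl] at hmin
  have hsplit : ∫ τ in s..t, 1 / g τ = (∫ τ in (0 : ℝ)..t, 1 / g τ) - ∫ τ in (0 : ℝ)..s, 1 / g τ := by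
    rw [intervalIntegral.integral_interval_sub_left
      (intervalIntegrable_of_continuousOn_Ici hg.continuousOn_one_div le_rfl ht)
      (intervalIntegrable_of_continuousOn_Ici hg.continuousOn_one_div le_rfl hs)]
  have hE : 0 < expDecay g C t := exp_pos _
  have e2 : exp (-C * ∫ τ in s..t, 1 / g τ) =
      exp (C * ∫ τ in (0 : ℝ)..s, 1 / g τ) * expDecay g C t := by
    rw [hsplit, expDecay, ← exp_add]; congr 1; ring
  have e3 : exp (C * ∫ τ in (0 : ℝ)..t, 1 / g τ) * expDecay g C t = 1 := by
    rw [expDecay, ← exp_add, ← exp_zero]; congr 1; ring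
  have h2 := mul_le_mul_of_nonneg_right hmin hE.le
  rw [max_mul_of_nonneg _ _ hE.le, mul_assoc, mul_assoc _ (exp (C * ∫ τ in (0 : ℝ)..t, 1 / g τ)),
    e3, ← e2, intervalIntegral.integral_same, mul_zero, exp_zero, mul_one, mul_one] at h2
  have h3 : bigG g s ^ (-β) ≤ d ^ β * ((g 0 + s) * g s) ^ (-β) := by
    have := rpow_le_rpow_of_nonpos (hpos s hs) (hdG s hs) (neg_nonpos.2 hβ)
    rw [mul_rpow hd.le (hG s hs).le, rpow_neg hd.le, inv_mul_le_iff₀ (rpow_pos_of_pos hd _)] at this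
    exact this
  have h4 : ((g 0 + t) * g t) ^ (-β) ≤ c ^ β * bigG g t ^ (-β) := by
    have := rpow_le_rpow_of_nonpos (hG t ht) (hcG t ht) (neg_nonpos.2 hβ)
    rw [mul_rpow hc.le (hpos t ht).le, rpow_neg hc.le,
      inv_mul_le_iff₀ (rpow_pos_of_pos hc _)] at this
    exact this
  set M := max (bigG g t ^ (-β)) (expDecay g C t)
  have hM : 0 < M := lt_max_of_lt_right hE
  have hK₀ : 1 ≤ K₀ := le_max_left _ _
  have h5 : max (((g 0 + 0) * g 0) ^ (-β) * expDecay g C t) (((g 0 + t) * g t) ^ (-β)) ≤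
      max (c ^ β) 1 * K₀ * M := by
    refine max_le ?_ (h4.trans ?_)
    · refine mul_le_mul ?_ (le_max_right _ _) hE.le (by positivity)
      exact (le_max_right _ _).trans (le_mul_of_one_le_left (by positivity) (le_max_right _ _))
    · refine mul_le_mul ?_ (le_max_left _ _) (rpow_nonneg (hG t ht).le _) (by positivity)
      exact (le_max_left _ _).trans (le_mul_of_one_le_right (by positivity) hK₀)
  calc bigG g s ^ (-β) * exp (-C * ∫ τ in s..t, 1 / g τ)
      ≤ d ^ β * ((g 0 + s) * g s) ^ (-β) * exp (-C * ∫ τ in s..t, 1 / g τ) :=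
        mul_le_mul_of_nonneg_right h3 (exp_pos _).le
    _ ≤ d ^ β * (max (c ^ β) 1 * K₀ * M) := by
        rw [mul_assoc]
        exact mul_le_mul_of_nonneg_left (h2.trans h5) (rpow_nonneg hd.le _)
    _ = d ^ β * (max (c ^ β) 1 * K₀) * M := by ring
    _ ≤ K₁ * M := mul_le_mul_of_nonneg_right (le_max_right _ _) hM.le

omit hg in
theorem half_mul_sq_le_modeRate {a x : ℝ} (ha : 0 ≤ a) (hx : 0 ≤ x) (h : x * a ≤ 1) :
    2⁻¹ * a ^ 2 * x ≤ modeRate a x := by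
  unfold modeRate
  rw [le_div_iff₀ (by positivity)]
  have h1 : (x * a) ^ 2 ≤ 1 := pow_le_one₀ (by positivity) h
  have h2 : 0 ≤ x * a ^ 2 := by positivity
  nlinarith

omit hg in
theorem half_mul_one_div_le_modeRate {a x : ℝ} (hx : 0 < x) (h : 1 ≤ x * a) :
    2⁻¹ * (1 / x) ≤ modeRate a x := by
  unfold modeRate
  rw [le_div_iff₀ (by positivity), mul_one_div, div_mul_eq_mul_div, div_le_iff₀ hx]
  have h1 : 1 ≤ (x * a) ^ 2 := one_le_pow₀ h
  nlinarith

/-- The time at which the modes of frequency `a` turn from oscillating to overdamped ones. -/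
theorem exists_transition {a t : ℝ} (ha : 0 ≤ a) (ht : 0 ≤ t) (h0 : g 0 * a ≤ 1) :
    ∃ s, 0 ≤ s ∧ s ≤ t ∧ (∀ τ ∈ Icc 0 s, g τ * a ≤ 1) ∧ ∀ τ ∈ Ioc s t, 1 ≤ g τ * a := by
  have hmono : MonotoneOn (fun τ => g τ * a) (Ici 0) := fun x hx y hy hxy =>
    mul_le_mul_of_nonneg_right (hg.monotoneOn hx hy hxy) ha
  rcases le_total (g t * a) 1 with h | h
  · exact ⟨t, ht, le_rfl, fun τ hτ => (hmono hτ.1 ht hτ.2).trans h,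
      fun τ hτ => absurd hτ.1 (not_lt.2 hτ.2)⟩
  · obtain ⟨s, hs, hs1⟩ := intermediate_value_Icc (f := fun τ => g τ * a) ht
      ((hg.continuousOn.mul continuousOn_const).mono Icc_subset_Ici_self) ⟨h0, h⟩
    exact ⟨s, hs.1, hs.2, fun τ hτ => (hmono hτ.1 hs.1 hτ.2).trans hs1.le,
      fun τ hτ => hs1.ge.trans (hmono hs.1 (hs.1.trans hτ.1.le) hτ.1.le)⟩

theorem le_integral_modeRate_of_one_le {a s t : ℝ} (hs : 0 ≤ s) (hst : s ≤ t)
    (h : ∀ τ ∈ Ioc s t, 1 ≤ g τ * a) :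
    2⁻¹ * ∫ τ in s..t, 1 / g τ ≤ ∫ τ in s..t, modeRate a (g τ) := by
  have ht := hs.trans hst
  rw [← intervalIntegral.integral_const_mul]
  refine intervalIntegral.integral_mono_on_of_le_Ioo hst
    ((intervalIntegrable_of_continuousOn_Ici hg.continuousOn_one_div hs ht).const_mul _)
    (intervalIntegrable_of_continuousOn_Ici
      ((continuous_modeRate a).comp_continuousOn hg.continuousOn) hs ht) fun τ hτ => ?_
  exact half_mul_one_div_le_modeRate (hg.pos τ (hs.trans hτ.1.le)) (h τ ⟨hτ.1, hτ.2.le⟩)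

theorem le_integral_modeRate_of_le_one {a s : ℝ} (ha : 0 ≤ a) (hs : 0 ≤ s)
    (h : ∀ τ ∈ Icc 0 s, g τ * a ≤ 1) :
    2⁻¹ * a ^ 2 * (bigG g s - 1) ≤ ∫ τ in (0 : ℝ)..s, modeRate a (g τ) := by
  rw [bigG, add_sub_cancel_left, ← intervalIntegral.integral_const_mul]
  refine intervalIntegral.integral_mono_on hs
    ((intervalIntegrable_of_continuousOn_Ici hg.continuousOn le_rfl hs).const_mul _)
    (intervalIntegrable_of_continuousOn_Ici
      ((continuous_modeRate a).comp_continuousOn hg.continuousOn) le_rfl hs) fun τ hτ => ?_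
  exact half_mul_sq_le_modeRate ha (hg.pos τ hτ.1).le (h τ hτ)

/-- Decay of the Fourier modes of frequency `a`, in terms of `decayRate`. -/
theorem exists_rpow_mul_exp_le {b : ℝ} (hb : 0 ≤ b) :
    ∃ K : ℝ, 1 ≤ K ∧ ∀ a t, 0 ≤ a → 0 ≤ t →
      a ^ b * exp (-(8⁻¹ * ∫ s in (0 : ℝ)..t, modeRate a (g s))) ≤
        K * decayRate g 16⁻¹ b t * (1 + a ^ 2) ^ (b / 2) := by
  have hβ : 0 ≤ b / 2 := by positivity
  obtain ⟨K₁, hK₁, h₁⟩ := hg.exists_bigG_rpow_mul_exp_le hβ 16⁻¹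
  obtain ⟨K₂, hK₂, h₂⟩ := exists_rpow_mul_exp_neg_le (b / 2) (c := 16⁻¹) (by norm_num)
  have h0 := hg.pos 0 le_rfl
  -- This pays for the -1 in G(s) - 1, since a ≤ 1/g 0 for every mode that is not overdamped
  -- initially.
  set K₃ := exp (16⁻¹ * (1 / g 0) ^ 2)
  have hK₃ : 1 ≤ K₃ := one_le_exp (by positivity)
  refine ⟨K₁ * K₂ * K₃, one_le_mul_of_one_le_of_one_le
    (one_le_mul_of_one_le_of_one_le hK₁ hK₂) hK₃, fun a t ha ht => ?_⟩
  have hsq : ∀ x : ℝ, 0 ≤ x → (x ^ 2) ^ (b / 2) = x ^ b := fun x hx => by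
    rw [← rpow_natCast, ← rpow_mul hx]; congr 1; push_cast; ring
  have hM : 0 < decayRate g 16⁻¹ b t := lt_max_of_lt_right (exp_pos _)
  -- If g 0 · a ≥ 1 the mode is overdamped at all times: only the exponential is available and a^b
  -- is absorbed by the weight (1 + a²)^(b/2). Otherwise the weight is not needed and a^b is traded
  -- for G(s)^(-b/2).
  rcases le_total 1 (g 0 * a) with h | h
  · have h3 := hg.le_integral_modeRate_of_one_le (a := a) le_rfl ht fun τ hτ =>
      h.trans (mul_le_mul_of_nonneg_right (hg.monotoneOn self_mem_Ici hτ.1.le hτ.1.le) ha)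
    have h4 : exp (-(8⁻¹ * ∫ s in (0 : ℝ)..t, modeRate a (g s))) ≤ decayRate g 16⁻¹ b t := by
      refine le_trans (exp_le_exp.2 ?_) (le_max_right _ _)
      linarith
    have h5 : a ^ b ≤ (1 + a ^ 2) ^ (b / 2) := by
      rw [← hsq a ha]
      exact rpow_le_rpow (by positivity) (by linarith) hβ
    have h6 : 1 ≤ K₁ * K₂ * K₃ :=
      one_le_mul_of_one_le_of_one_le (one_le_mul_of_one_le_of_one_le hK₁ hK₂) hK₃
    calc _ ≤ (1 + a ^ 2) ^ (b / 2) * decayRate g 16⁻¹ b t :=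
          mul_le_mul h5 h4 (exp_pos _).le (by positivity)
      _ = 1 * (decayRate g 16⁻¹ b t * (1 + a ^ 2) ^ (b / 2)) := by ring
      _ ≤ K₁ * K₂ * K₃ * (decayRate g 16⁻¹ b t * (1 + a ^ 2) ^ (b / 2)) :=
          mul_le_mul_of_nonneg_right h6 (by positivity)
      _ = _ := by ring
  · obtain ⟨s, hs, hst, hs1, hs2⟩ := hg.exists_transition ha ht h
    have hG : 0 < bigG g s := one_pos.trans_le (hg.one_le_bigG hs)
    have hc := (continuous_modeRate a).comp_continuousOn hg.continuousOn
    have hadd := intervalIntegral.integral_add_adjacent_intervals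
      (intervalIntegrable_of_continuousOn_Ici hc le_rfl hs)
      (intervalIntegrable_of_continuousOn_Ici hc hs ht)
    simp only [Function.comp_apply] at hadd
    have h3 := hg.le_integral_modeRate_of_le_one ha hs hs1
    have h4 := hg.le_integral_modeRate_of_one_le hs hst hs2
    have ha2 : a ^ 2 ≤ (1 / g 0) ^ 2 := by
      refine pow_le_pow_left₀ ha ?_ 2
      rw [le_div_iff₀ h0]; linarith
    have h5 : exp (-(8⁻¹ * ∫ s in (0 : ℝ)..t, modeRate a (g s))) ≤
        K₃ * exp (-(16⁻¹ * (a ^ 2 * bigG g s))) * exp (-16⁻¹ * ∫ τ in s..t, 1 / g τ) := by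
      rw [← exp_add, ← exp_add]
      refine exp_le_exp.2 ?_
      rw [← hadd]
      linarith
    have h6 := h₂ (a ^ 2 * bigG g s) (by positivity) hβ
    rw [mul_rpow (by positivity) hG.le, hsq a ha] at h6
    have h7 : a ^ b * exp (-(16⁻¹ * (a ^ 2 * bigG g s))) ≤ K₂ * bigG g s ^ (-(b / 2)) := by
      rw [rpow_neg hG.le, ← div_eq_mul_inv, le_div_iff₀ (by positivity)]
      linarith
    have h8 : 1 ≤ (1 + a ^ 2) ^ (b / 2) := one_le_rpow (by nlinarith) hβ
    calc _ ≤ a ^ b * (K₃ * exp (-(16⁻¹ * (a ^ 2 * bigG g s))) *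
            exp (-16⁻¹ * ∫ τ in s..t, 1 / g τ)) :=
          mul_le_mul_of_nonneg_left h5 (by positivity)
      _ = a ^ b * exp (-(16⁻¹ * (a ^ 2 * bigG g s))) *
            (K₃ * exp (-16⁻¹ * ∫ τ in s..t, 1 / g τ)) := by ring
      _ ≤ K₂ * bigG g s ^ (-(b / 2)) * (K₃ * exp (-16⁻¹ * ∫ τ in s..t, 1 / g τ)) :=
          mul_le_mul_of_nonneg_right h7 (by positivity)
      _ = K₂ * K₃ * (bigG g s ^ (-(b / 2)) * exp (-16⁻¹ * ∫ τ in s..t, 1 / g τ)) := by ring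
      _ ≤ K₂ * K₃ * (K₁ * decayRate g 16⁻¹ b t) :=
          mul_le_mul_of_nonneg_left (h₁ s t hs hst) (by positivity)
      _ = K₁ * K₂ * K₃ * decayRate g 16⁻¹ b t * 1 := by ring
      _ ≤ _ := mul_le_mul_of_nonneg_left h8 (by positivity)

end SlowlyIncreasing

/-! ### From the distributional equation to an equation in L² on the Fourier side. -/

/-- A function with weak derivative given by a continuous function is differentiable, where the
functionals used to test need only separate points. -/
theorem hasDerivAt_of_forall_hasDerivAt_comp {X ι : Type*} [NormedAddCommGroup X] [NormedSpace ℝ X]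
    [CompleteSpace X] {ℓ : ι → X →L[ℝ] ℂ} (hℓ : ∀ x, (∀ i, ℓ i x = 0) → x = 0) {f h : ℝ → X}
    (hh : ContinuousOn h (Ioi 0))
    (hf : ∀ i t, 0 < t → HasDerivAt (fun τ => ℓ i (f τ)) (ℓ i (h t)) t) {t : ℝ} (ht : 0 < t) :
    HasDerivAt f (h t) t := by
  set F : ℝ → X := fun τ => f t + ∫ s in t..τ, h s with hF
  have hFd : ∀ τ, 0 < τ → HasDerivAt F (h τ) τ := fun τ hτ => by
    refine (intervalIntegral.integral_hasDerivAt_right ?_ ?_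
      (hh.continuousAt (Ioi_mem_nhds hτ))).const_add _
    · exact (hh.mono fun x hx => (lt_min ht hτ).trans_le hx.1).intervalIntegrable
    · exact hh.stronglyMeasurableAtFilter isOpen_Ioi τ hτ
  have hEq : ∀ τ, 0 < τ → f τ = F τ := fun τ hτ => by
    refine sub_eq_zero.1 (hℓ _ fun i => ?_)
    have hd : ∀ s, 0 < s → HasDerivAt (fun s => ℓ i (f s) - ℓ i (F s)) 0 s := fun s hs =>
      ((hf i s hs).sub ((ℓ i).hasFDerivAt.comp_hasDerivAt s (hFd s hs))).congr_deriv (sub_self _)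
    have := isOpen_Ioi.is_const_of_deriv_eq_zero isPreconnected_Ioi
      (fun s hs => (hd s hs).differentiableAt.differentiableWithinAt)
      (fun s hs => (hd s hs).deriv) hτ ht
    simpa [hF] using this
  exact (hFd t ht).congr_of_eventuallyEq
    ((eventually_gt_nhds ht).mono fun τ hτ => hEq τ hτ)

section Multiplication

variable {n : ℕ}

/-- Multiplication by a bounded function on `L²`. -/
noncomputable def mulL2 {m : Rn n → ℂ} (hm : MemLp m ∞ volume) : L2 n →L[ℂ] L2 n :=
  ((ContinuousLinearMap.lsmul ℂ ℂ).holderL volume ∞ 2 2) (hm.toLp m)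

theorem coeFn_mulL2 {m : Rn n → ℂ} (hm : MemLp m ∞ volume) (f : L2 n) :
    mulL2 hm f =ᵐ[volume] fun ξ => m ξ * f ξ := by
  have h := (ContinuousLinearMap.lsmul ℂ ℂ).coeFn_holder (r := 2) (hm.toLp m) f
  filter_upwards [h, hm.coeFn_toLp] with ξ h1 h2
  have : mulL2 hm f = (ContinuousLinearMap.lsmul ℂ ℂ).holder 2 (hm.toLp m) f := rfl
  rw [this, h1, h2]
  rfl

theorem mulL2_eq_smul {m : Rn n → ℂ} (hm : MemLp m ∞ volume) (f : L2 n) :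
    mulL2 hm f = (hm.toLp m • f : L2 n) := by
  ext1
  filter_upwards [coeFn_mulL2 hm f, Lp.coeFn_lpSMul (r := 2) (hm.toLp m) f, hm.coeFn_toLp]
    with ξ h1 h2 h3
  rw [h1, h2, Pi.smul_apply', h3, smul_eq_mul]

theorem mulL2_mulL2 {m₁ m₂ m : Rn n → ℂ} (h₁ : MemLp m₁ ∞ volume) (h₂ : MemLp m₂ ∞ volume)
    (h : MemLp m ∞ volume) (hm : ∀ ξ, m₁ ξ * m₂ ξ = m ξ) (f : L2 n) :
    mulL2 h₁ (mulL2 h₂ f) = mulL2 h f := by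
  ext1
  filter_upwards [coeFn_mulL2 h₁ (mulL2 h₂ f), coeFn_mulL2 h₂ f, coeFn_mulL2 h f] with ξ e1 e2 e3
  rw [e1, e2, e3, ← hm, mul_assoc]

/-- The symbol of the Bessel potential of order `2`. -/
noncomputable def besselSymbol (n : ℕ) (ξ : Rn n) : ℂ := ((1 + ‖ξ‖ ^ 2) ^ (-1 : ℝ) : ℝ)

/-- The symbol of the Bessel potential of order `2`, composed with the Laplacian. -/
noncomputable def besselLaplacianSymbol (n : ℕ) (ξ : Rn n) : ℂ :=
  -((2 * π * ‖ξ‖) ^ 2 : ℝ) * besselSymbol n ξ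

theorem hasTemperateGrowth_besselSymbol : (besselSymbol n).HasTemperateGrowth := by
  unfold besselSymbol
  fun_prop

theorem hasTemperateGrowth_besselLaplacianSymbol :
    (besselLaplacianSymbol n).HasTemperateGrowth := by
  have h : besselLaplacianSymbol n =
      (fun ξ => ((-(2 * π) ^ 2 : ℝ) : ℂ) * Complex.ofReal (‖ξ‖ ^ 2)) * besselSymbol n := by
    ext ξ
    simp only [besselLaplacianSymbol, Pi.mul_apply]
    push_cast
    ring
  rw [h]
  exact Function.HasTemperateGrowth.mul (by fun_prop) hasTemperateGrowth_besselSymbol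

theorem memLp_besselSymbol : MemLp (besselSymbol n) ∞ volume := by
  refine memLp_top_of_bound
    hasTemperateGrowth_besselSymbol.1.continuous.aestronglyMeasurable 1 (ae_of_all _ fun ξ => ?_)
  rw [besselSymbol, Complex.norm_real, norm_of_nonneg (by positivity)]
  exact rpow_le_one_of_one_le_of_nonpos (by nlinarith [sq_nonneg ‖ξ‖]) (by norm_num)

theorem memLp_besselLaplacianSymbol : MemLp (besselLaplacianSymbol n) ∞ volume := by
  refine memLp_top_of_bound
    hasTemperateGrowth_besselLaplacianSymbol.1.continuous.aestronglyMeasurable ((2 * π) ^ 2)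
    (ae_of_all _ fun ξ => ?_)
  rw [besselLaplacianSymbol, besselSymbol, norm_mul, norm_neg, Complex.norm_real,
    Complex.norm_real, norm_of_nonneg (by positivity), norm_of_nonneg (by positivity),
    rpow_neg_one, ← div_eq_mul_inv, div_le_iff₀ (by positivity)]
  nlinarith [sq_nonneg (2 * π)]

theorem toTemperedDistribution_mulL2 {m : Rn n → ℂ} (hm : MemLp m ∞ volume)
    (hm' : m.HasTemperateGrowth) (f : L2 n) (φ : 𝓢(Rn n, ℂ)) :
    Lp.toTemperedDistribution (mulL2 hm (𝓕 f)) φ =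
      Lp.toTemperedDistribution f (𝓕 (SchwartzMap.smulLeftCLM ℂ m φ)) := by
  rw [mulL2_eq_smul, Lp.toTemperedDistribution_smul_eq hm' hm,
    TemperedDistribution.smulLeftCLM_apply_apply, ← Lp.fourier_toTemperedDistribution_eq]
  rfl

/-- Against test functions 𝓕((1 + |ξ|²)⁻¹ φ) the Laplacian becomes a bounded multiplier, so its
pairing is that of an L² function. -/
theorem laplacian_toTemperedDistribution_apply (f : L2 n) (φ : 𝓢(Rn n, ℂ)) :
    Δ (Lp.toTemperedDistribution f) (𝓕 (SchwartzMap.smulLeftCLM ℂ (besselSymbol n) φ)) =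
      Lp.toTemperedDistribution (mulL2 memLp_besselLaplacianSymbol (𝓕 f)) φ := by
  rw [toTemperedDistribution_mulL2 _ hasTemperateGrowth_besselLaplacianSymbol,
    TemperedDistribution.laplacian_eq_fourierMultiplierCLM]
  have h : besselLaplacianSymbol n =
      (-(2 * π) ^ 2 : ℂ) • ((fun ξ => Complex.ofReal (‖ξ‖ ^ 2)) * besselSymbol n) := by
    ext ξ
    simp only [besselLaplacianSymbol, Pi.mul_apply, Pi.smul_apply, smul_eq_mul]
    push_cast
    ring
  rw [h, SchwartzMap.smulLeftCLM_smul
    (Function.HasTemperateGrowth.mul (by fun_prop) hasTemperateGrowth_besselSymbol)]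
  simp only [smul_apply, TemperedDistribution.fourierMultiplierCLM_apply_apply,
    FourierTransform.fourierInv_fourier_eq, FourierTransform.fourier_smul, map_smul]
  rw [SchwartzMap.smulLeftCLM_smulLeftCLM_apply (by fun_prop) hasTemperateGrowth_besselSymbol,
    ← Complex.coe_smul]
  push_cast
  rfl

theorem eq_zero_of_toTemperedDistribution {f : L2 n}
    (h : ∀ φ : 𝓢(Rn n, ℂ), Lp.toTemperedDistribution f φ = 0) : f = 0 := by
  have := Lp.ker_toTemperedDistributionCLM_eq_bot (F := ℂ) (μ := (volume : Measure (Rn n))) (p := 2)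
  rw [LinearMap.ker_eq_bot'] at this
  exact this f (by ext φ; exact h φ)

/-- Pairing with a Schwartz function, as a continuous functional on `L²`. -/
noncomputable def pairL2 (φ : 𝓢(Rn n, ℂ)) : L2 n →L[ℂ] ℂ :=
  PointwiseConvergenceCLM.evalCLM _ _ φ ∘L Lp.toTemperedDistributionCLM ℂ volume 2

theorem pairL2_apply (φ : 𝓢(Rn n, ℂ)) (f : L2 n) :
    pairL2 φ f = Lp.toTemperedDistribution f φ := rfl

end Multiplication

section Reduction

variable {n : ℕ}

/-- The Fourier transform on `L²` as a real-linear map. -/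
noncomputable def fourierRealCLM (n : ℕ) : L2 n →L[ℝ] L2 n :=
  ((Lp.fourierTransformₗᵢ (Rn n) ℂ).toContinuousLinearEquiv : L2 n →L[ℂ] L2 n).restrictScalars ℝ

end Reduction

namespace IsSobolevSolution

variable {n : ℕ} {g : ℝ → ℝ} {u₀ u₁ : L2 n} {u : ℝ → L2 n} (hu : IsSobolevSolution g u₀ u₁ u)
include hu

theorem continuousOn_timeDeriv : ContinuousOn (timeDeriv u) (Ici 0) :=
  hu.contDiff.continuousOn_derivWithin (uniqueDiffOn_Ici 0) le_rfl

theorem hasDerivAt {t : ℝ} (ht : 0 < t) : HasDerivAt u (timeDeriv u t) t :=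
  ((hu.contDiff.differentiableOn one_ne_zero) t ht.le).hasDerivWithinAt.hasDerivAt (Ici_mem_nhds ht)

theorem continuousOn_fourier : ContinuousOn (fun t => (𝓕 (u t) : L2 n)) (Ici 0) :=
  (fourierRealCLM n).continuous.comp_continuousOn hu.contDiff.continuousOn

theorem continuousOn_fourier_timeDeriv :
    ContinuousOn (fun t => (𝓕 (timeDeriv u t) : L2 n)) (Ici 0) :=
  (fourierRealCLM n).continuous.comp_continuousOn hu.continuousOn_timeDeriv

theorem hasDerivAt_fourier {t : ℝ} (ht : 0 < t) :
    HasDerivAt (fun t => (𝓕 (u t) : L2 n)) (𝓕 (timeDeriv u t)) t :=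
  (fourierRealCLM n).hasFDerivAt.comp_hasDerivAt t (hu.hasDerivAt ht)

/-- The equation on the Fourier side, regularized in order to hold in `L²`. -/
theorem hasDerivAt_bessel (hg : ContinuousOn g (Ici 0)) {t : ℝ} (ht : 0 < t) :
    HasDerivAt (fun t => mulL2 memLp_besselSymbol (𝓕 (timeDeriv u t)))
      (mulL2 memLp_besselLaplacianSymbol (𝓕 (u t) + g t • 𝓕 (timeDeriv u t))) t := by
  refine hasDerivAt_of_forall_hasDerivAt_comp
    (ℓ := fun φ : 𝓢(Rn n, ℂ) => (pairL2 φ).restrictScalars ℝ)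
    (h := fun t => mulL2 memLp_besselLaplacianSymbol (𝓕 (u t) + g t • 𝓕 (timeDeriv u t)))
    (fun f hf => eq_zero_of_toTemperedDistribution hf) ?_ (fun φ t ht => ?_) ht
  · exact ((mulL2 memLp_besselLaplacianSymbol).continuous.comp_continuousOn
      (hu.continuousOn_fourier.add (hg.smul hu.continuousOn_fourier_timeDeriv))).mono
        Ioi_subset_Ici_self
  -- This choice of test function inserts the Bessel factor into every term, so both sides become
  -- pairings of L² functions with φ.
  · have h := hu.equation (𝓕 (SchwartzMap.smulLeftCLM ℂ (besselSymbol n) φ)) t ht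
    rw [laplacian_toTemperedDistribution_apply, laplacian_toTemperedDistribution_apply] at h
    simp only [← toTemperedDistribution_mulL2 memLp_besselSymbol hasTemperateGrowth_besselSymbol,
      ← pairL2_apply] at h
    refine h.congr_deriv ?_
    rw [RCLike.real_smul_eq_coe_smul (K := ℂ) (g t)]
    simp only [ContinuousLinearMap.coe_restrictScalars', map_add, map_smul, smul_eq_mul]
    rfl

end IsSobolevSolution

/-! ### Localization to bounded frequency sets and the energy estimate there. -/

section Multiplication

variable {n : ℕ}

theorem memLp_indicator_ofReal {S : Set (Rn n)} (hS : MeasurableSet S) {R : ℝ}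
    (hSR : S ⊆ Metric.closedBall 0 R) {r : Rn n → ℝ} (hr : Continuous r) :
    MemLp (fun ξ => ((S.indicator r ξ : ℝ) : ℂ)) ∞ volume := by
  obtain ⟨C, hC⟩ := (isCompact_closedBall (0 : Rn n) R).exists_bound_of_continuousOn hr.continuousOn
  refine memLp_top_of_bound ?_ (max C 0) (ae_of_all _ fun ξ => ?_)
  · exact (Complex.measurable_ofReal.comp (hr.measurable.indicator hS)).aestronglyMeasurable
  · rw [Complex.norm_real]
    by_cases h : ξ ∈ S
    · rw [indicator_of_mem h]
      exact (hC ξ (hSR h)).trans (le_max_left _ _)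
    · rw [indicator_of_notMem h, norm_zero]
      exact le_max_right _ _

theorem inner_ofReal_mul_left (r : ℝ) (z w : ℂ) : inner ℝ ((r : ℂ) * z) w = r * inner ℝ z w := by
  rw [← Complex.real_smul, real_inner_smul_left]

theorem inner_ofReal_mul_right (r : ℝ) (z w : ℂ) : inner ℝ z ((r : ℂ) * w) = r * inner ℝ z w := by
  rw [← Complex.real_smul, real_inner_smul_right]

theorem inner_mulL2_left {r : Rn n → ℝ} (hr : MemLp (fun ξ => (r ξ : ℂ)) ∞ volume) (f h : L2 n) :
    inner ℝ (mulL2 hr f) h = ∫ ξ, r ξ * inner ℝ (f ξ) (h ξ) := by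
  rw [L2.inner_def]
  refine integral_congr_ae ?_
  filter_upwards [coeFn_mulL2 hr f] with ξ hξ
  rw [hξ, inner_ofReal_mul_left]

theorem inner_mulL2_right {r : Rn n → ℝ} (hr : MemLp (fun ξ => (r ξ : ℂ)) ∞ volume) (f h : L2 n) :
    inner ℝ f (mulL2 hr h) = ∫ ξ, r ξ * inner ℝ (f ξ) (h ξ) := by
  rw [L2.inner_def]
  refine integral_congr_ae ?_
  filter_upwards [coeFn_mulL2 hr h] with ξ hξ
  rw [hξ, inner_ofReal_mul_right]

theorem inner_mulL2_self_nonneg {r : Rn n → ℝ} (hr : MemLp (fun ξ => (r ξ : ℂ)) ∞ volume)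
    (h0 : ∀ ξ, 0 ≤ r ξ) (f : L2 n) : 0 ≤ inner ℝ (mulL2 hr f) f := by
  rw [inner_mulL2_left]
  exact integral_nonneg fun ξ => mul_nonneg (h0 ξ) real_inner_self_nonneg

theorem integrable_mul_norm_sq {r : Rn n → ℝ} (hr : MemLp (fun ξ => (r ξ : ℂ)) ∞ volume)
    (f : L2 n) : Integrable (fun ξ => r ξ * ‖f ξ‖ ^ 2) := by
  refine (L2.integrable_inner (𝕜 := ℝ) (mulL2 hr f) f).congr ?_
  filter_upwards [coeFn_mulL2 hr f] with ξ hξ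
  rw [hξ, inner_ofReal_mul_left, real_inner_self_eq_norm_sq]

theorem inner_mulL2_mulL2_indicator {S : Set (Rn n)} (hS : MeasurableSet S) {r : Rn n → ℝ}
    (hr : MemLp (fun ξ => (r ξ : ℂ)) ∞ volume)
    (hχ : MemLp (fun ξ => ((S.indicator (fun _ => (1 : ℝ)) ξ : ℝ) : ℂ)) ∞ volume) (f : L2 n) :
    inner ℝ (mulL2 hr (mulL2 hχ f)) (mulL2 hχ f) = ∫ ξ in S, r ξ * ‖f ξ‖ ^ 2 := by
  rw [inner_mulL2_left, ← integral_indicator hS]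
  refine integral_congr_ae ?_
  filter_upwards [coeFn_mulL2 hχ f] with ξ hξ
  rw [hξ, real_inner_self_eq_norm_sq]
  by_cases h : ξ ∈ S <;> simp [h]

theorem inner_mulL2_indicator_self {S : Set (Rn n)} (hS : MeasurableSet S)
    (hχ : MemLp (fun ξ => ((S.indicator (fun _ => (1 : ℝ)) ξ : ℝ) : ℂ)) ∞ volume) (f : L2 n) :
    inner ℝ (mulL2 hχ f) (mulL2 hχ f) = ∫ ξ in S, ‖f ξ‖ ^ 2 := by
  rw [L2.inner_def, ← integral_indicator hS]
  refine integral_congr_ae ?_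
  filter_upwards [coeFn_mulL2 hχ f] with ξ hξ
  rw [hξ, real_inner_self_eq_norm_sq]
  by_cases h : ξ ∈ S <;> simp [h]

theorem integrable_norm_sq (f : L2 n) : Integrable (fun ξ => ‖f ξ‖ ^ 2) :=
  (L2.integrable_inner (𝕜 := ℝ) f f).congr (ae_of_all _ fun _ => real_inner_self_eq_norm_sq _)

end Multiplication

namespace IsSobolevSolution

variable {n : ℕ} {g : ℝ → ℝ} {u₀ u₁ : L2 n} {u : ℝ → L2 n} (hu : IsSobolevSolution g u₀ u₁ u)
include hu

/-- The equation on the Fourier side, localized to a bounded set of frequencies. -/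
theorem hasDerivAt_localized (hg : ContinuousOn g (Ici 0)) {S : Set (Rn n)} (hS : MeasurableSet S)
    {R : ℝ} (hSR : S ⊆ Metric.closedBall 0 R)
    (hχ : MemLp (fun ξ => ((S.indicator (fun _ => (1 : ℝ)) ξ : ℝ) : ℂ)) ∞ volume)
    (hp : MemLp (fun ξ => (((Metric.closedBall (0 : Rn n) R).indicator
      (fun ξ => (2 * π * ‖ξ‖) ^ 2) ξ : ℝ) : ℂ)) ∞ volume) {t : ℝ} (ht : 0 < t) :
    HasDerivAt (fun t => mulL2 hχ (𝓕 (timeDeriv u t)))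
      (-(g t • mulL2 hp (mulL2 hχ (𝓕 (timeDeriv u t)))) - mulL2 hp (mulL2 hχ (𝓕 (u t)))) t := by
  -- Multiplying by 1 + |ξ|² on S undoes the Bessel potential; this is a bounded operation because S
  -- is bounded.
  have hc : MemLp (fun ξ => ((S.indicator (fun ξ => 1 + ‖ξ‖ ^ 2) ξ : ℝ) : ℂ)) ∞ volume :=
    memLp_indicator_ofReal hS hSR (by fun_prop)
  have hj : ∀ f, mulL2 hc (mulL2 memLp_besselSymbol f) = mulL2 hχ f :=
    mulL2_mulL2 hc memLp_besselSymbol hχ fun ξ => by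
      by_cases h : ξ ∈ S
      · rw [indicator_of_mem h, indicator_of_mem h, besselSymbol, ← Complex.ofReal_mul,
          rpow_neg_one, mul_inv_cancel₀ (by positivity)]
      · simp [h]
  have hq : ∀ f, mulL2 hc (mulL2 memLp_besselLaplacianSymbol f) = -mulL2 hp (mulL2 hχ f) := by
    intro f
    ext1
    filter_upwards [coeFn_mulL2 hc (mulL2 memLp_besselLaplacianSymbol f),
      coeFn_mulL2 memLp_besselLaplacianSymbol f, Lp.coeFn_neg (mulL2 hp (mulL2 hχ f)),
      coeFn_mulL2 hp (mulL2 hχ f), coeFn_mulL2 hχ f] with ξ h1 h2 h3 h4 h5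
    rw [h1, h2, h3, Pi.neg_apply, h4, h5]
    by_cases h : ξ ∈ S
    · have e : ((1 + ‖ξ‖ ^ 2 : ℝ) : ℂ) * besselSymbol n ξ = 1 := by
        rw [besselSymbol, ← Complex.ofReal_mul, rpow_neg_one, mul_inv_cancel₀ (by positivity),
          Complex.ofReal_one]
      rw [indicator_of_mem h, indicator_of_mem h, indicator_of_mem (hSR h), besselLaplacianSymbol,
        Complex.ofReal_one]
      linear_combination (-(((2 * π * ‖ξ‖) ^ 2 : ℝ) : ℂ) * f ξ) * e
    · simp [h]
  have h := ((mulL2 hc).restrictScalars ℝ).hasFDerivAt.comp_hasDerivAt t (hu.hasDerivAt_bessel hg ht)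
  have e : (((mulL2 hc).restrictScalars ℝ) ∘ fun t => mulL2 memLp_besselSymbol (𝓕 (timeDeriv u t))) =
      fun t => mulL2 hχ (𝓕 (timeDeriv u t)) := funext fun t => hj _
  rw [e] at h
  refine h.congr_deriv ?_
  change mulL2 hc (mulL2 memLp_besselLaplacianSymbol _) = _
  rw [hq, RCLike.real_smul_eq_coe_smul (K := ℂ) (g t), RCLike.real_smul_eq_coe_smul (K := ℂ) (g t)]
  simp only [map_add, map_smul]
  abel

/-- Energy estimate for the frequencies in a bounded set. -/
theorem setIntegral_energy_le (hg : SlowlyIncreasing g) {S : Set (Rn n)} (hS : MeasurableSet S)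
    {R a : ℝ} (ha : 0 ≤ a) (hSR : S ⊆ Metric.closedBall 0 R) (hSa : ∀ ξ ∈ S, a ≤ 2 * π * ‖ξ‖)
    {t : ℝ} (ht : 0 ≤ t) :
    ∫ ξ in S, (‖(𝓕 (timeDeriv u t) : L2 n) ξ‖ ^ 2 + (2 * π * ‖ξ‖) ^ 2 * ‖(𝓕 (u t) : L2 n) ξ‖ ^ 2) ≤
      4 * exp 2 * exp (-(4⁻¹ * ∫ s in (0 : ℝ)..t, modeRate a (g s))) *
        ∫ ξ in S, (‖(𝓕 u₁ : L2 n) ξ‖ ^ 2 + (2 * π * ‖ξ‖) ^ 2 * ‖(𝓕 u₀ : L2 n) ξ‖ ^ 2) := by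
  have hχ : MemLp (fun ξ => ((S.indicator (fun _ => (1 : ℝ)) ξ : ℝ) : ℂ)) ∞ volume :=
    memLp_indicator_ofReal hS hSR (by fun_prop)
  -- Truncating (2π|ξ|)² to the ball makes the operator A bounded on all of L² without changing it
  -- on S.
  have hp : MemLp (fun ξ => (((Metric.closedBall (0 : Rn n) R).indicator
      (fun ξ => (2 * π * ‖ξ‖) ^ 2) ξ : ℝ) : ℂ)) ∞ volume :=
    memLp_indicator_ofReal measurableSet_closedBall subset_rfl (by fun_prop)
  have hpS : ∀ f : L2 n, inner ℝ (mulL2 hp (mulL2 hχ f)) (mulL2 hχ f) =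
      ∫ ξ in S, (2 * π * ‖ξ‖) ^ 2 * ‖f ξ‖ ^ 2 := fun f => by
    rw [inner_mulL2_mulL2_indicator hS]
    refine setIntegral_congr_fun hS fun ξ hξ => ?_
    simp only [indicator_of_mem (hSR hξ)]
  have hpi : ∀ f : L2 n, IntegrableOn (fun ξ => (2 * π * ‖ξ‖) ^ 2 * ‖f ξ‖ ^ 2) S := fun f => by
    refine (integrable_mul_norm_sq hp f).integrableOn.congr_fun (fun ξ hξ => ?_) hS
    simp only [indicator_of_mem (hSR hξ)]
  -- Coercivity with constant a² is available only for functions supported in S, hence only along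
  -- the localized solution.
  have hcoer : ∀ f : L2 n, a ^ 2 * ‖mulL2 hχ f‖ ^ 2 ≤
      inner ℝ (mulL2 hp (mulL2 hχ f)) (mulL2 hχ f) := fun f => by
    rw [hpS, ← real_inner_self_eq_norm_sq, inner_mulL2_indicator_self hS, ← integral_const_mul]
    refine setIntegral_mono_on ((integrable_norm_sq f).integrableOn.const_mul _) (hpi f) hS
      fun ξ hξ => ?_
    exact mul_le_mul_of_nonneg_right (pow_le_pow_left₀ ha (hSa ξ hξ) 2) (sq_nonneg _)
  have h := energy_decay (A := (mulL2 hp).restrictScalars ℝ) (a := a) hg.continuousOn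
    (fun t ht => (hg.pos t ht).le) (fun t => hg.hasDerivAt)
    (fun t ht => hg.deriv_nonneg t ht.le)
    (fun y z => (inner_mulL2_left hp y z).trans (inner_mulL2_right hp y z).symm)
    (inner_mulL2_self_nonneg hp fun ξ => indicator_nonneg (fun _ _ => sq_nonneg _) ξ) ha
    (w := fun t => mulL2 hχ (𝓕 (u t))) (v := fun t => mulL2 hχ (𝓕 (timeDeriv u t)))
    ((mulL2 hχ).continuous.comp_continuousOn hu.continuousOn_fourier)
    ((mulL2 hχ).continuous.comp_continuousOn hu.continuousOn_fourier_timeDeriv)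
    (fun t ht => ((mulL2 hχ).restrictScalars ℝ).hasFDerivAt.comp_hasDerivAt t
      (hu.hasDerivAt_fourier ht))
    (fun t ht => hu.hasDerivAt_localized hg.continuousOn hS hSR hχ hp ht)
    (fun t _ => hcoer _) (fun t _ => hcoer _) ht
  simp only [ContinuousLinearMap.coe_restrictScalars', hpS, inner_mulL2_indicator_self hS,
    hu.init, hu.init_deriv] at h
  rwa [← integral_add (integrable_norm_sq _).integrableOn (hpi _),
    ← integral_add (integrable_norm_sq _).integrableOn (hpi _)] at h

/-- Pointwise energy estimate on the Fourier side. -/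
theorem ae_energy_le (hg : SlowlyIncreasing g) {t : ℝ} (ht : 0 ≤ t) :
    ∀ᵐ ξ : Rn n, ∀ a : ℚ, 0 ≤ a → (a : ℝ) ≤ 2 * π * ‖ξ‖ →
      ‖(𝓕 (timeDeriv u t) : L2 n) ξ‖ ^ 2 + (2 * π * ‖ξ‖) ^ 2 * ‖(𝓕 (u t) : L2 n) ξ‖ ^ 2 ≤
      4 * exp 2 * exp (-(4⁻¹ * ∫ s in (0 : ℝ)..t, modeRate a (g s))) *
        (‖(𝓕 u₁ : L2 n) ξ‖ ^ 2 + (2 * π * ‖ξ‖) ^ 2 * ‖(𝓕 u₀ : L2 n) ξ‖ ^ 2) := by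
  -- Restricting a to the countable set ℚ allows one null set to serve all a.
  rw [ae_all_iff]
  intro a
  by_cases ha : 0 ≤ a
  swap
  · exact ae_of_all _ fun ξ h => absurd h ha
  have ha' : (0 : ℝ) ≤ a := by exact_mod_cast ha
  have key : ∀ N : ℕ, ∀ᵐ ξ : Rn n, ‖ξ‖ ≤ N → (a : ℝ) ≤ 2 * π * ‖ξ‖ →
      ‖(𝓕 (timeDeriv u t) : L2 n) ξ‖ ^ 2 + (2 * π * ‖ξ‖) ^ 2 * ‖(𝓕 (u t) : L2 n) ξ‖ ^ 2 ≤
      4 * exp 2 * exp (-(4⁻¹ * ∫ s in (0 : ℝ)..t, modeRate a (g s))) *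
        (‖(𝓕 u₁ : L2 n) ξ‖ ^ 2 + (2 * π * ‖ξ‖) ^ 2 * ‖(𝓕 u₀ : L2 n) ξ‖ ^ 2) := by
    intro N
    set B : Set (Rn n) := Metric.closedBall 0 N ∩ {ξ | (a : ℝ) ≤ 2 * π * ‖ξ‖} with hB
    have hBm : MeasurableSet B := measurableSet_closedBall.inter
      (measurableSet_le measurable_const (by fun_prop))
    have hp : MemLp (fun ξ => (((Metric.closedBall (0 : Rn n) N).indicator
        (fun ξ => (2 * π * ‖ξ‖) ^ 2) ξ : ℝ) : ℂ)) ∞ volume :=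
      memLp_indicator_ofReal measurableSet_closedBall subset_rfl (by fun_prop)
    have hint : ∀ f h : L2 n, Integrable
        (B.indicator fun ξ => ‖f ξ‖ ^ 2 + (2 * π * ‖ξ‖) ^ 2 * ‖h ξ‖ ^ 2) := fun f h => by
      refine IntegrableOn.integrable_indicator ?_ hBm
      refine (integrable_norm_sq f).integrableOn.add ?_
      refine (integrable_mul_norm_sq hp h).integrableOn.congr_fun (fun ξ hξ => ?_) hBm
      simp only [indicator_of_mem hξ.1]
    have h := ae_le_of_forall_setIntegral_le (hint (𝓕 (timeDeriv u t)) (𝓕 (u t)))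
      ((hint (𝓕 u₁) (𝓕 u₀)).const_mul
        (4 * exp 2 * exp (-(4⁻¹ * ∫ s in (0 : ℝ)..t, modeRate a (g s))))) fun s hs _ => by
        rw [integral_const_mul, setIntegral_indicator hBm, setIntegral_indicator hBm]
        exact hu.setIntegral_energy_le hg (hs.inter hBm) ha' (fun ξ hξ => hξ.2.1)
          (fun ξ hξ => hξ.2.2) ht
    filter_upwards [h] with ξ hξ h1 h2
    have hξB : ξ ∈ B := ⟨mem_closedBall_zero_iff.2 h1, h2⟩
    rwa [indicator_of_mem hξB, indicator_of_mem hξB] at hξ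
  filter_upwards [ae_all_iff.2 key] with ξ hξ _ h
  obtain ⟨N, hN⟩ := exists_nat_ge ‖ξ‖
  exact hξ N hN h

end IsSobolevSolution

/-! ### From pointwise decay to Sobolev norms. -/

/-- The decay rate is evaluated at a rational a comparable to the true frequency p; replacing p by
2a costs only powers of 2. -/
theorem exists_rat_between_half {p : ℝ} (hp : 0 ≤ p) :
    ∃ a : ℚ, 0 ≤ a ∧ (a : ℝ) ≤ p ∧ p ≤ 2 * a := by
  rcases hp.eq_or_lt with rfl | hp
  · exact ⟨0, le_rfl, by simp, by simp⟩
  · obtain ⟨a, h1, h2⟩ := exists_rat_btwn (half_lt_self hp)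
    refine ⟨a, ?_, h2.le, by linarith⟩
    exact_mod_cast ((half_pos hp).trans h1).le

/-- The square root of the energy bound is X ≤ c D (z + p y). The extra p in front of y is why `u₀`
is measured with exponent b + 1 and `u₁` with exponent b. -/
theorem rpow_mul_le_of_energy_le {b p a D X y z c M₀ M₁ : ℝ} (hb : 0 ≤ b) (ha : 0 ≤ a)
    (hap : a ≤ p) (hpa : p ≤ 2 * a) (hD : 0 ≤ D) (hX : 0 ≤ X) (hy : 0 ≤ y) (hz : 0 ≤ z)
    (hc : 0 ≤ c) (h : X ^ 2 ≤ (c * D) ^ 2 * (z ^ 2 + p ^ 2 * y ^ 2)) (hM₀ : 0 ≤ M₀) (hM₁ : 0 ≤ M₁)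
    (h₀ : a ^ (b + 1) * D ≤ M₀ * (1 + a ^ 2) ^ ((b + 1) / 2))
    (h₁ : a ^ b * D ≤ M₁ * (1 + a ^ 2) ^ (b / 2)) :
    p ^ b * X ≤ c * 2 ^ (b + 1) * M₀ * ((1 + p ^ 2) ^ ((b + 1) / 2) * y) +
      c * 2 ^ b * M₁ * ((1 + p ^ 2) ^ (b / 2) * z) := by
  have hp : 0 ≤ p := ha.trans hap
  have h2 : ∀ β M : ℝ, 0 ≤ β → 0 ≤ M → a ^ β * D ≤ M * (1 + a ^ 2) ^ (β / 2) →
      p ^ β * D ≤ 2 ^ β * M * (1 + p ^ 2) ^ (β / 2) := fun β M hβ hM hβ' => by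
    have e1 : p ^ β ≤ 2 ^ β * a ^ β := by
      rw [← mul_rpow two_pos.le ha]
      exact rpow_le_rpow hp hpa hβ
    have e2 : (1 + a ^ 2) ^ (β / 2) ≤ (1 + p ^ 2) ^ (β / 2) :=
      rpow_le_rpow (by positivity) (by nlinarith) (by positivity)
    calc p ^ β * D ≤ 2 ^ β * a ^ β * D := mul_le_mul_of_nonneg_right e1 hD
      _ = 2 ^ β * (a ^ β * D) := by ring
      _ ≤ 2 ^ β * (M * (1 + p ^ 2) ^ (β / 2)) :=
        mul_le_mul_of_nonneg_left (hβ'.trans (mul_le_mul_of_nonneg_left e2 hM)) (by positivity)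
      _ = _ := by ring
  have hXle : X ≤ c * D * (z + p * y) := by
    refine (sq_le_sq₀ hX (by positivity)).1 (h.trans ?_)
    rw [mul_pow (c * D)]
    refine mul_le_mul_of_nonneg_left ?_ (by positivity)
    nlinarith [mul_nonneg (mul_nonneg hp hy) hz]
  have e : p ^ (b + 1) = p ^ b * p := rpow_add_one' hp (by positivity)
  calc p ^ b * X ≤ p ^ b * (c * D * (z + p * y)) :=
        mul_le_mul_of_nonneg_left hXle (by positivity)
    _ = c * y * (p ^ (b + 1) * D) + c * z * (p ^ b * D) := by rw [e]; ring
    _ ≤ c * y * (2 ^ (b + 1) * M₀ * (1 + p ^ 2) ^ ((b + 1) / 2)) +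
        c * z * (2 ^ b * M₁ * (1 + p ^ 2) ^ (b / 2)) :=
      add_le_add
        (mul_le_mul_of_nonneg_left (h2 _ _ (by positivity) hM₀ h₀) (by positivity))
        (mul_le_mul_of_nonneg_left (h2 _ _ hb hM₁ h₁) (by positivity))
    _ = _ := by ring

theorem decayRate_pos (g : ℝ → ℝ) (C r t : ℝ) : 0 < decayRate g C r t :=
  lt_max_of_lt_right (exp_pos _)

/-- Pointwise decay on the Fourier side. -/
theorem SlowlyIncreasing.exists_ae_decay {n : ℕ} {g : ℝ → ℝ} (hg : SlowlyIncreasing g) {b : ℝ}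
    (hb : 0 ≤ b) :
    ∃ K : ℝ, 0 < K ∧ ∀ (u₀ u₁ : L2 n) (u : ℝ → L2 n), IsSobolevSolution g u₀ u₁ u → ∀ t : ℝ, 0 ≤ t →
      ∀ᵐ ξ : Rn n, ∀ X : ℝ, X = ‖(𝓕 (timeDeriv u t) : L2 n) ξ‖ ∨
          X = 2 * π * ‖ξ‖ * ‖(𝓕 (u t) : L2 n) ξ‖ →
        (2 * π * ‖ξ‖) ^ b * X ≤
          K * decayRate g 16⁻¹ (b + 1) t *
            ((1 + (2 * π * ‖ξ‖) ^ 2) ^ ((b + 1) / 2) * ‖(𝓕 u₀ : L2 n) ξ‖) +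
          K * decayRate g 16⁻¹ b t *
            ((1 + (2 * π * ‖ξ‖) ^ 2) ^ (b / 2) * ‖(𝓕 u₁ : L2 n) ξ‖) := by
  obtain ⟨K₀, hK₀, h₀⟩ := hg.exists_rpow_mul_exp_le (b := b + 1) (by positivity)
  obtain ⟨K₁, hK₁, h₁⟩ := hg.exists_rpow_mul_exp_le hb
  set c := 2 * exp 1
  have hc : 0 < c := by positivity
  refine ⟨c * 2 ^ (b + 1) * K₀ + c * 2 ^ b * K₁, by positivity, fun u₀ u₁ u hu t ht => ?_⟩
  filter_upwards [hu.ae_energy_le hg ht] with ξ hξ X hX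
  obtain ⟨a, ha0, hap, hpa⟩ := exists_rat_between_half (p := 2 * π * ‖ξ‖) (by positivity)
  have ha0' : (0 : ℝ) ≤ a := by exact_mod_cast ha0
  have h := hξ a ha0 hap
  have hM₀ := decayRate_pos g 16⁻¹ (b + 1) t
  have hM₁ := decayRate_pos g 16⁻¹ b t
  set D := exp (-(8⁻¹ * ∫ s in (0 : ℝ)..t, modeRate a (g s))) with hD
  -- Passing from energy to amplitude takes a square root: 4e² = (2e)², and the rate 1/4 becomes
  -- 1/8.
  have hcD : 4 * exp 2 * exp (-(4⁻¹ * ∫ s in (0 : ℝ)..t, modeRate a (g s))) = (c * D) ^ 2 := by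
    rw [mul_pow, mul_pow, hD, ← exp_nat_mul, ← exp_nat_mul]
    push_cast
    ring_nf
  rw [hcD] at h
  have hX0 : 0 ≤ X := by rcases hX with rfl | rfl <;> positivity
  have hX2 : X ^ 2 ≤ ‖(𝓕 (timeDeriv u t) : L2 n) ξ‖ ^ 2 +
      (2 * π * ‖ξ‖) ^ 2 * ‖(𝓕 (u t) : L2 n) ξ‖ ^ 2 := by
    rcases hX with rfl | rfl
    · simp only [le_add_iff_nonneg_right]; positivity
    · rw [mul_pow _ ‖_‖]; simp
  refine (rpow_mul_le_of_energy_le hb ha0' hap hpa (exp_pos _).le hX0 (norm_nonneg _)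
    (norm_nonneg _) hc.le (hX2.trans h) (by positivity) (by positivity) (h₀ a t ha0' ht)
    (h₁ a t ha0' ht)).trans ?_
  have hA : 0 ≤ c * 2 ^ (b + 1) * K₀ := by positivity
  have hB : 0 ≤ c * 2 ^ b * K₁ := by positivity
  rw [← mul_assoc _ K₀, ← mul_assoc _ K₁]
  gcongr <;> linarith

theorem eLpNorm_le_of_ae_le {n : ℕ} {F : Rn n → ℂ} {m₀ m₁ : Rn n → ℝ} (hm₀ : Measurable m₀)
    (hm₁ : Measurable m₁) (h₀ : ∀ ξ, 0 ≤ m₀ ξ) (h₁ : ∀ ξ, 0 ≤ m₁ ξ) {f₀ f₁ : L2 n} {c₀ c₁ : ℝ}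
    (hc₀ : 0 ≤ c₀) (hc₁ : 0 ≤ c₁)
    (h : ∀ᵐ ξ, ‖F ξ‖ ≤ c₀ * (m₀ ξ * ‖f₀ ξ‖) + c₁ * (m₁ ξ * ‖f₁ ξ‖)) :
    eLpNorm F 2 volume ≤ ENNReal.ofReal c₀ * eLpNorm (fun ξ => m₀ ξ • f₀ ξ) 2 volume +
      ENNReal.ofReal c₁ * eLpNorm (fun ξ => m₁ ξ • f₁ ξ) 2 volume := by
  have key : ∀ (m : Rn n → ℝ) (f : L2 n) (c : ℝ), (∀ ξ, 0 ≤ m ξ) → 0 ≤ c →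
      eLpNorm (fun ξ => c * (m ξ * ‖f ξ‖)) 2 volume =
        ENNReal.ofReal c * eLpNorm (fun ξ => m ξ • f ξ) 2 volume := fun m f c hm hc => by
    rw [← eLpNorm_norm (fun ξ => m ξ • f ξ), ← Real.enorm_of_nonneg hc, ← eLpNorm_const_smul]
    congr 1
    ext ξ
    simp [abs_of_nonneg (hm ξ)]
  have hmeas : ∀ (m : Rn n → ℝ) (f : L2 n) (c : ℝ), Measurable m →
      AEStronglyMeasurable (fun ξ => c * (m ξ * ‖f ξ‖)) volume := fun m f c hm =>
    (hm.aestronglyMeasurable.mul (Lp.aestronglyMeasurable f).norm).const_mul c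
  rw [← key m₀ f₀ c₀ h₀ hc₀, ← key m₁ f₁ c₁ h₁ hc₁]
  exact (eLpNorm_mono_ae_real h).trans
    (eLpNorm_add_le (hmeas m₀ f₀ c₀ hm₀) (hmeas m₁ f₁ c₁ hm₁) one_le_two)

/-- |D|u and u_t are controlled by the same energy, so they obey the same bound; the estimate for u
at order b comes from order b - 1 here. -/
theorem SlowlyIncreasing.exists_homNorm_le {n : ℕ} {g : ℝ → ℝ} (hg : SlowlyIncreasing g) {b : ℝ}
    (hb : 0 ≤ b) :
    ∃ K : ℝ, 0 < K ∧ ∀ (u₀ u₁ : L2 n) (u : ℝ → L2 n), IsSobolevSolution g u₀ u₁ u → ∀ t : ℝ, 0 ≤ t →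
      homNorm (b + 1) (u t) ≤
          ENNReal.ofReal (K * decayRate g 16⁻¹ (b + 1) t) * sobNorm (b + 1) u₀ +
          ENNReal.ofReal (K * decayRate g 16⁻¹ b t) * sobNorm b u₁ ∧
      homNorm b (timeDeriv u t) ≤
          ENNReal.ofReal (K * decayRate g 16⁻¹ (b + 1) t) * sobNorm (b + 1) u₀ +
          ENNReal.ofReal (K * decayRate g 16⁻¹ b t) * sobNorm b u₁ := by
  obtain ⟨K, hK, h⟩ := hg.exists_ae_decay (n := n) hb
  refine ⟨K, hK, fun u₀ u₁ u hu t ht => ?_⟩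
  have hM₀ := decayRate_pos g 16⁻¹ (b + 1) t
  have hM₁ := decayRate_pos g 16⁻¹ b t
  constructor
  all_goals
    refine eLpNorm_le_of_ae_le (by fun_prop) (by fun_prop) (fun ξ => by positivity)
      (fun ξ => by positivity) (by positivity) (by positivity) ?_
    filter_upwards [h u₀ u₁ u hu t ht] with ξ hξ
  · refine le_of_eq_of_le ?_ (hξ _ (Or.inr rfl))
    rw [norm_smul, norm_of_nonneg (by positivity), rpow_add_one' (by positivity) (by positivity),
      mul_assoc]
  · refine le_of_eq_of_le ?_ (hξ _ (Or.inl rfl))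
    rw [norm_smul, norm_of_nonneg (by positivity)]

/-- The asymptotic bound extends to all t ≥ 0 because on a compact interval the exponential is at
most 1 and G is bounded. It passes to every s ≤ r because G ≥ 1. -/
theorem SlowlyIncreasing.exists_expDecay_le {g : ℝ → ℝ} (hg : SlowlyIncreasing g) {C r : ℝ}
    (hC : 0 ≤ C) (hr : 0 ≤ r) (h : expDecay g C =O[atTop] fun t => bigG g t ^ (-(r / 2))) :
    ∃ K : ℝ, 1 ≤ K ∧ ∀ s t, s ≤ r → 0 ≤ t → decayRate g C s t ≤ K * bigG g t ^ (-(s / 2)) := by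
  obtain ⟨c, hc⟩ := h.bound
  obtain ⟨T, hT⟩ := eventually_atTop.1 hc
  have hG : ∀ t, 0 ≤ t → 0 < bigG g t := fun t ht => one_pos.trans_le (hg.one_le_bigG ht)
  set T' := max T 0
  have hle : ∀ t, 0 ≤ t → expDecay g C t ≤ 1 := fun t ht => by
    refine exp_le_one_iff.2 (mul_nonpos_of_nonpos_of_nonneg (neg_nonpos.2 hC) ?_)
    exact intervalIntegral.integral_nonneg ht fun s hs => one_div_nonneg.2 (hg.pos s hs.1).le
  have hGmono : ∀ t, 0 ≤ t → t ≤ T' → bigG g t ≤ bigG g T' := fun t ht htT => by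
    have h1 := intervalIntegral.integral_add_adjacent_intervals
      (intervalIntegrable_of_continuousOn_Ici hg.continuousOn le_rfl ht)
      (intervalIntegrable_of_continuousOn_Ici hg.continuousOn ht (ht.trans htT))
    have h2 := intervalIntegral.integral_nonneg (μ := volume) htT
      fun s hs => (hg.pos s (ht.trans hs.1)).le
    unfold bigG
    linarith
  set K := max (max c (bigG g T' ^ (r / 2))) 1
  have key : ∀ t, 0 ≤ t → expDecay g C t ≤ K * bigG g t ^ (-(r / 2)) := fun t ht => by
    have hGt := rpow_pos_of_pos (hG t ht) (-(r / 2))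
    rcases le_total T t with h | h
    · have := hT t h
      rw [norm_of_nonneg (show 0 ≤ expDecay g C t from (exp_pos _).le),
        norm_of_nonneg hGt.le] at this
      refine this.trans (mul_le_mul_of_nonneg_right ?_ hGt.le)
      exact (le_max_left _ _).trans (le_max_left _ _)
    · refine (hle t ht).trans ?_
      have h1 : bigG g t ^ (r / 2) ≤ K :=
        (rpow_le_rpow (hG t ht).le (hGmono t ht (h.trans (le_max_left _ _))) (by positivity)).trans
          ((le_max_right _ _).trans (le_max_left _ _))
      rw [rpow_neg (hG t ht).le, ← div_eq_mul_inv, le_div_iff₀ (rpow_pos_of_pos (hG t ht) _),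
        one_mul]
      exact h1
  refine ⟨K, le_max_right _ _, fun s t hs ht => max_le ?_ ((key t ht).trans ?_)⟩
  · exact le_mul_of_one_le_left (rpow_nonneg (hG t ht).le _) (le_max_right _ _)
  · refine mul_le_mul_of_nonneg_left ?_ (zero_le_one.trans (le_max_right _ _))
    exact rpow_le_rpow_of_exponent_le (hg.one_le_bigG ht) (by linarith)

theorem ofReal_mul_decayRate_le {g : ℝ → ℝ} {C s t K L : ℝ} (hK : 0 ≤ K)
    (h : decayRate g C s t ≤ L * bigG g t ^ (-(s / 2))) (x : ℝ≥0∞) :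
    ENNReal.ofReal (K * decayRate g C s t) * x ≤
      ENNReal.ofReal (K * L * bigG g t ^ (-(s / 2))) * x := by
  refine mul_le_mul_left (ENNReal.ofReal_le_ofReal ?_) x
  rw [mul_assoc]
  exact mul_le_mul_of_nonneg_left h hK

theorem mainTheorem5 (n : ℕ) (g : ℝ → ℝ) (hg : SlowlyIncreasing g) :
    ∃ C : ℝ, 0 < C ∧
      -- higher order energies of `u`
      (∀ b : ℝ, 1 ≤ b → ∃ K : ℝ, 0 < K ∧
        ∀ (u₀ u₁ : L2 n) (u : ℝ → L2 n), IsSobolevSolution g u₀ u₁ u → ∀ t : ℝ, 0 ≤ t →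
          homNorm b (u t) ≤
            ENNReal.ofReal (K * decayRate g C b t) * sobNorm b u₀ +
            ENNReal.ofReal (K * decayRate g C (b - 1) t) * sobNorm (b - 1) u₁) ∧
      -- higher order energies of `u_t`
      (∀ b : ℝ, 0 ≤ b → ∃ K : ℝ, 0 < K ∧
        ∀ (u₀ u₁ : L2 n) (u : ℝ → L2 n), IsSobolevSolution g u₀ u₁ u → ∀ t : ℝ, 0 ≤ t →
          homNorm b (timeDeriv u t) ≤
            ENNReal.ofReal (K * decayRate g C (b + 1) t) * sobNorm (b + 1) u₀ +
            ENNReal.ofReal (K * decayRate g C b t) * sobNorm b u₁) ∧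
      -- parabolic effect for `u`, if the polynomial-type term dominates
      (∀ b : ℝ, 1 ≤ b → (expDecay g C =O[atTop] fun t => bigG g t ^ (-(b / 2))) →
        ∃ K : ℝ, 0 < K ∧
        ∀ (u₀ u₁ : L2 n) (u : ℝ → L2 n), IsSobolevSolution g u₀ u₁ u → ∀ t : ℝ, 0 ≤ t →
          homNorm b (u t) ≤
            ENNReal.ofReal (K * bigG g t ^ (-(b / 2))) * sobNorm b u₀ +
            ENNReal.ofReal (K * bigG g t ^ (-((b - 1) / 2))) * sobNorm (b - 1) u₁) ∧
      -- parabolic effect for `u_t`, if the polynomial-type term dominates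
      (∀ b : ℝ, 0 ≤ b → (expDecay g C =O[atTop] fun t => bigG g t ^ (-((b + 1) / 2))) →
        ∃ K : ℝ, 0 < K ∧
        ∀ (u₀ u₁ : L2 n) (u : ℝ → L2 n), IsSobolevSolution g u₀ u₁ u → ∀ t : ℝ, 0 ≤ t →
          homNorm b (timeDeriv u t) ≤
            ENNReal.ofReal (K * bigG g t ^ (-((b + 1) / 2))) * sobNorm (b + 1) u₀ +
            ENNReal.ofReal (K * bigG g t ^ (-(b / 2))) * sobNorm b u₁) := by
  -- The value 1/16 is the energy rate 1/4, halved for the amplitude and halved again by the lower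
  -- bound 1/(2g) on the rate of an overdamped mode.
  refine ⟨16⁻¹, by norm_num, fun b hb => ?_, fun b hb => ?_, fun b hb hO => ?_, fun b hb hO => ?_⟩
  · obtain ⟨K, hK, h⟩ := hg.exists_homNorm_le (n := n) (sub_nonneg.2 hb)
    rw [sub_add_cancel] at h
    exact ⟨K, hK, fun u₀ u₁ u hu t ht => (h u₀ u₁ u hu t ht).1⟩
  · obtain ⟨K, hK, h⟩ := hg.exists_homNorm_le (n := n) hb
    exact ⟨K, hK, fun u₀ u₁ u hu t ht => (h u₀ u₁ u hu t ht).2⟩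
  · obtain ⟨K, hK, h⟩ := hg.exists_homNorm_le (n := n) (sub_nonneg.2 hb)
    obtain ⟨L, hL, h'⟩ := hg.exists_expDecay_le (by norm_num) (zero_le_one.trans hb) hO
    rw [sub_add_cancel] at h
    exact ⟨K * L, by positivity, fun u₀ u₁ u hu t ht => (h u₀ u₁ u hu t ht).1.trans
      (add_le_add (ofReal_mul_decayRate_le hK.le (h' _ t le_rfl ht) _)
        (ofReal_mul_decayRate_le hK.le (h' _ t (by linarith) ht) _))⟩
  · obtain ⟨K, hK, h⟩ := hg.exists_homNorm_le (n := n) hb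
    obtain ⟨L, hL, h'⟩ := hg.exists_expDecay_le (by norm_num) (by positivity) hO
    exact ⟨K * L, by positivity, fun u₀ u₁ u hu t ht => (h u₀ u₁ u hu t ht).2.trans
      (add_le_add (ofReal_mul_decayRate_le hK.le (h' _ t le_rfl ht) _)
        (ofReal_mul_decayRate_le hK.le (h' _ t (by linarith) ht) _))⟩
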